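/- Let $f=\sum_{k\ge 0}a_kz^k$ be a formal power series with real coefficients $a_k$. For $n=0,1,2,\dots$ let $$A(f,n)(z)=\sum_{k=0}^{n}\frac{n!}{(n-k)!}\,a_k z^{n-k}$$ be the $n$-th Appell polynomial of $f$. For an entire function $g\not\equiv 0$ and $X\subset\mathbb C$, let $N(g;X)$ denote the number of zeros of $g$ in $X$, counted with multiplicity, and put $N(g;X)=0$ if $g\equiv 0$. Let $N_n=N(A(f,n);\mathbb C\setminus\mathbb R)$. The Laguerre–Pólya class $\mathcal{LP}$ consists of the entire functions of the form $$g(z)=c\,z^m e^{-\alpha z^2+\beta z}\prod_j\Bigl(1-\frac{z}{b_j}\Bigr)e^{z/b_j},$$ where $c,\beta\in\mathbb R$, $m$ is a nonnegative integer, $\alpha\ge 0$, and $(b_j)$ is a finite (possibly empty) or infinite sequence of nonzero real numbers with $\sum_j|b_j|^{-2}<\infty$. The class $\mathcal{LP}^*$ consists of the entire functions that map $\mathbb R$ into $\mathbb R$ and are of the form $Pg$ with $P$ a polynomial with real coefficients and $g\in\mathcal{LP}$. We say that $f$ represents an entire function if the series converges at every $z\in\mathbb C$; the function is then its sum. Then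 the following hold. 1. $0=N_0=N_1\le N_2\le N_3\le\cdots$. 2. If $f$ represents an entire function in $\mathcal{LP}^*$ (also denoted $f$) and $N=N(f;\mathbb C\setminus\mathbb R)$, then $N_n\le N$ for all $n$, and $N_n=N$ for all sufficiently large $n$. 3. If the sequence $\langle N_n\rangle$ is bounded, then $f$ represents an entire function in $\mathcal{LP}^*$. -/

import Mathlib

noncomputable section

namespace LaguerrePolya

/-- The function `F` is the entire function represented by the formal power series `f`:
the series converges at every complex point, with sum `F z`. -/
def Represents (f : PowerSeries ℝ) (F : ℂ → ℂ) : Prop :=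
  ∀ z : ℂ, HasSum (fun k : ℕ => ((PowerSeries.coeff k f : ℝ) : ℂ) * z ^ k) (F z)

/-- The `n`-th Appell polynomial `∑_{k=0}^n n!/(n-k)! a_k z^{n-k}` of `f = ∑ a_k z^k`. -/
def appell (f : PowerSeries ℝ) (n : ℕ) : Polynomial ℝ :=
  ∑ k ∈ Finset.range (n + 1),
    Polynomial.C ((n.factorial : ℝ) / ((n - k).factorial : ℝ) * PowerSeries.coeff k f) *
      Polynomial.X ^ (n - k)

open Classical in
/-- The number `N(F; X)` of zeros in `X` of the entire function `F`, counted according to their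
multiplicities (a zero `z` of order `m` contributes the pairs `(z, 0), …, (z, m - 1)`); it is `0`
by convention if `F` vanishes identically. -/
def zeroCount (F : ℂ → ℂ) (X : Set ℂ) : ℕ∞ :=
  if F = 0 then 0
  else Set.encard {p : ℂ × ℕ | p.1 ∈ X ∧ (p.2 : ℕ∞) < analyticOrderAt F p.1}

/-- The set `ℂ ∖ ℝ`. -/
def nonreal : Set ℂ := (Set.range ((↑) : ℝ → ℂ))ᶜ

/-- The number of non-real zeros of the `n`-th Appell polynomial of `f`. -/
def appellNonrealZeros (f : PowerSeries ℝ) (n : ℕ) : ℕ∞ :=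
  zeroCount (fun z : ℂ => Polynomial.aeval z (appell f n)) nonreal

/-- The Laguerre-Pólya class: the functions
`c z^m exp(-α z^2 + β z) ∏_j (1 - z / a_j) exp(z / a_j)` with `c, β, a_j` real, `α ≥ 0`,
`a_j ≠ 0` and `∑_j |a_j|^{-2} < ∞`. The (finite or infinite) family of the `a_j` is
indexed by a set `J` of natural numbers. -/
def IsLP (F : ℂ → ℂ) : Prop :=
  ∃ (c : ℝ) (m : ℕ) (α β : ℝ) (J : Set ℕ) (a : J → ℝ) (G : ℂ → ℂ),
    0 ≤ α ∧ (∀ j, a j ≠ 0) ∧ Summable (fun j => (|a j| ^ 2)⁻¹) ∧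
    (∀ z : ℂ, HasProd (fun j => (1 - z / (a j : ℂ)) * Complex.exp (z / (a j : ℂ))) (G z)) ∧
    ∀ z : ℂ, F z = (c : ℂ) * z ^ m * Complex.exp (-(α : ℂ) * z ^ 2 + (β : ℂ) * z) * G z

/-- Real entire functions: entire functions that map `ℝ` into `ℝ`. -/
def IsRealEntire (F : ℂ → ℂ) : Prop :=
  Differentiable ℂ F ∧ ∀ x : ℝ, ∃ y : ℝ, F (x : ℂ) = (y : ℂ)

/-- The class `LP*` of the real entire functions `P g` with `P` a real polynomial and `g` in the
Laguerre-Pólya class. -/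
def IsLPStar (F : ℂ → ℂ) : Prop :=
  IsRealEntire F ∧ ∃ (P : Polynomial ℝ) (g : ℂ → ℂ), IsLP g ∧
    ∀ z : ℂ, F z = Polynomial.aeval z P * g z

end LaguerrePolya

end

/-! ### Non-real zeros of real polynomials -/

namespace LaguerrePolya

open Polynomial Filter Topology

/-! Monotonicity is Rolle's theorem: differentiation does not increase the number of non-real zeros
of a real polynomial, and the derivative of the `(n+1)`-st Appell polynomial is `n+1` times the
`n`-th.

The rest goes through `limitClass M`, the coefficientwise closure of the real polynomials with
constant term `1` and at most `M` non-real zeros. Its structure theorem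
`exists_eq_mul_of_mem_limitClass` says that a member is `Q * g` with `deg Q ≤ M` and `g` a
Laguerre–Pólya function without non-real zeros. The proof follows the power sums of the reciprocal
zeros of the approximating polynomials. By Newton's identities these converge exactly when the
coefficients do. A recurrence argument on a torus bounds the reciprocals of the non-real zeros, so
along a subsequence they converge and yield `Q`. For the real ones, the power sums of order at least
`3` pass to the limit, the second may lose a nonnegative mass `2α`, and the first is unconstrained.
This is where the factor `exp(-αz² + βz)` comes from.

Reversed Appell polynomials, rescaled by `z ↦ z/n`, converge to `f`. Hence bounded `N_n` puts `f`,
stripped of a factor `c z^m`, into some `limitClass B`, and assertion 3 follows together with the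
bound `B` on the number of non-real zeros of the sum.

Conversely, a function in `LP*` is, up to `c z^m`, in `limitClass N`. Passing to the reversed Appell
polynomial preserves this class, since on polynomials it is a limit of reversals, derivatives and
rescalings. The structure theorem also shows that a polynomial in `limitClass N` has at most `N`
non-real zeros, so `N_n ≤ N`. Applying the bound from assertion 3 with `B = max N_n` gives `N ≤ max
N_n`. -/

/-- The number of non-real zeros of a real polynomial, computed from its real roots. -/
noncomputable def nonrealDegree (p : ℝ[X]) : ℕ := p.natDegree - Multiset.card p.roots

theorem nonrealDegree_add_card_roots (p : ℝ[X]) :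
    nonrealDegree p + Multiset.card p.roots = p.natDegree :=
  Nat.sub_add_cancel p.card_roots'

@[simp] theorem nonrealDegree_zero : nonrealDegree 0 = 0 := by simp [nonrealDegree]

theorem nonrealDegree_le_natDegree (p : ℝ[X]) : nonrealDegree p ≤ p.natDegree := Nat.sub_le _ _

/-- Separates the real zeros from the rest. Operations that keep the first factor split and do not
raise the degree of the second cannot increase `nonrealDegree`. -/
theorem exists_splits_mul (p : ℝ[X]) :
    ∃ s q : ℝ[X], p = s * q ∧ s.Splits ∧ q.natDegree = nonrealDegree p ∧ q.roots = 0 := by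
  obtain ⟨q, h1, h2, h3⟩ := p.exists_prod_multiset_X_sub_C_mul
  refine ⟨_, q, h1.symm, Splits.multisetProd ?_, ?_, h3⟩
  · intro f hf
    obtain ⟨a, -, rfl⟩ := Multiset.mem_map.1 hf
    exact Splits.X_sub_C a
  · have := nonrealDegree_add_card_roots p
    omega

theorem nonrealDegree_splits_mul {s : ℝ[X]} (hs : s.Splits) (hs0 : s ≠ 0) (q : ℝ[X]) :
    nonrealDegree (s * q) = nonrealDegree q := by
  rcases eq_or_ne q 0 with rfl | hq
  · simp
  have h1 := nonrealDegree_add_card_roots (s * q)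
  have h2 := nonrealDegree_add_card_roots q
  rw [roots_mul (mul_ne_zero hs0 hq), natDegree_mul hs0 hq, Multiset.card_add,
    hs.natDegree_eq_card_roots] at h1
  omega

theorem nonrealDegree_splits_mul_le {s : ℝ[X]} (hs : s.Splits) (q : ℝ[X]) :
    nonrealDegree (s * q) ≤ nonrealDegree q := by
  rcases eq_or_ne s 0 with rfl | hs0
  · simp
  · exact (nonrealDegree_splits_mul hs hs0 q).le

/-- Rolle with multiplicities: the degree drops by one and the number of real roots by at most one.
Constants are separate because the degree then does not drop. -/
theorem nonrealDegree_derivative_le (p : ℝ[X]) :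
    nonrealDegree (derivative p) ≤ nonrealDegree p := by
  have h1 := nonrealDegree_add_card_roots p
  have h2 := nonrealDegree_add_card_roots (derivative p)
  have h3 := p.card_roots_le_derivative
  have h4 := natDegree_derivative_le p
  rcases Nat.eq_zero_or_pos p.natDegree with h | h
  · have : nonrealDegree (derivative p) ≤ (derivative p).natDegree := nonrealDegree_le_natDegree _
    omega
  · omega

theorem nonrealDegree_iterate_derivative_le (p : ℝ[X]) (k : ℕ) :
    nonrealDegree (derivative^[k] p) ≤ nonrealDegree p := by
  induction k with
  | zero => simp
  | succ k ih =>
    rw [Function.iterate_succ_apply']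
    exact (nonrealDegree_derivative_le _).trans ih

theorem splits_reverse {s : ℝ[X]} (hs : s.Splits) : s.reverse.Splits := by
  rw [hs.eq_prod_roots, reverse_mul_of_domain]
  refine Splits.mul (Splits.of_natDegree_le_one (by simp)) ?_
  generalize s.roots = m
  induction m using Multiset.induction_on with
  | empty => rw [Multiset.map_zero, Multiset.prod_zero, ← C_1, reverse_C]; exact Splits.C _
  | cons a m ih =>
    rw [Multiset.map_cons, Multiset.prod_cons, reverse_mul_of_domain]
    refine Splits.mul (Splits.of_natDegree_le_one ?_) ih
    exact (reverse_natDegree_le _).trans (natDegree_X_sub_C_le a)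

theorem nonrealDegree_reverse_le (p : ℝ[X]) : nonrealDegree p.reverse ≤ nonrealDegree p := by
  obtain ⟨s, q, h, hs, hq, -⟩ := exists_splits_mul p
  have : p.reverse = s.reverse * q.reverse := by rw [h, reverse_mul_of_domain]
  rw [this, ← hq]
  exact (nonrealDegree_splits_mul_le (splits_reverse hs) _).trans
    ((nonrealDegree_le_natDegree _).trans (reverse_natDegree_le q))

theorem nonrealDegree_comp_le (p : ℝ[X]) {l : ℝ[X]} (hl : l.natDegree ≤ 1) :
    nonrealDegree (p.comp l) ≤ nonrealDegree p := by
  obtain ⟨s, q, h, hs, hq, -⟩ := exists_splits_mul p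
  have : p.comp l = s.comp l * q.comp l := by rw [h, mul_comp]
  rw [this, ← hq]
  refine (nonrealDegree_splits_mul_le (hs.comp_of_natDegree_le_one hl) _).trans
    ((nonrealDegree_le_natDegree _).trans ?_)
  rw [natDegree_comp]
  exact (Nat.mul_le_mul_left _ hl).trans (by simp)

theorem nonrealDegree_C_mul {c : ℝ} (hc : c ≠ 0) (p : ℝ[X]) :
    nonrealDegree (C c * p) = nonrealDegree p :=
  nonrealDegree_splits_mul (Splits.C c) (by simpa using hc) p

theorem nonrealDegree_X_pow_mul (m : ℕ) (p : ℝ[X]) :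
    nonrealDegree (X ^ m * p) = nonrealDegree p :=
  nonrealDegree_splits_mul (Splits.X_pow m) (by simp) p

theorem analyticOrderAt_aeval {p : ℝ[X]} (hp : p ≠ 0) (z : ℂ) :
    analyticOrderAt (fun w : ℂ => aeval w p) z
      = ((p.map (algebraMap ℝ ℂ)).roots.count z : ℕ∞) := by
  have hp' : p.map (algebraMap ℝ ℂ) ≠ 0 := by simpa using hp
  have han : AnalyticAt ℂ (fun w : ℂ => aeval w p) z :=
    (Polynomial.differentiable_aeval p).analyticAt z
  rw [han.analyticOrderAt_eq_natCast, count_roots]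
  obtain ⟨q, hq, hdvd⟩ := exists_eq_pow_rootMultiplicity_mul_and_not_dvd _ hp' z
  refine ⟨fun w => q.eval w, q.differentiable.analyticAt z, fun h => hdvd (dvd_iff_isRoot.2 h), ?_⟩
  refine Eventually.of_forall fun w => ?_
  have := congrArg (eval w) hq
  simpa [eval_map_algebraMap] using this

/-- Links the analytic count to the algebraic one: off the real axis `G` does not vanish, so every
order there is a root multiplicity of `p` over `ℂ`. -/
theorem zeroCount_aeval_mul {p : ℝ[X]} (hp : p ≠ 0) {G : ℂ → ℂ} (hG : Differentiable ℂ G)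
    (hG0 : ∀ z ∈ nonreal, G z ≠ 0) :
    zeroCount (fun z => aeval z p * G z) nonreal = nonrealDegree p := by
  classical
  set R := (p.map (algebraMap ℝ ℂ)).roots with hR
  have hord : ∀ z ∈ nonreal, analyticOrderAt (fun w => aeval w p * G w) z = (R.count z : ℕ∞) := by
    intro z hz
    have h1 : analyticOrderAt G z = 0 := (hG.analyticAt z).analyticOrderAt_eq_zero.2 (hG0 z hz)
    have := analyticOrderAt_mul (f := fun w : ℂ => aeval w p) (g := G)
      ((Polynomial.differentiable_aeval p).analyticAt z) (hG.analyticAt z)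
    rw [h1, add_zero, analyticOrderAt_aeval hp] at this
    exact this
  -- The order at one non-real point is finite, so the product is not identically zero and the
  -- default value of `zeroCount` is not used.
  have hI : Complex.I ∈ nonreal := by
    rintro ⟨x, hx⟩
    simpa using congrArg Complex.im hx
  have hne : (fun z => aeval z p * G z) ≠ 0 := by
    intro h
    have := hord _ hI
    rw [h, show (0 : ℂ → ℂ) = fun _ => 0 from rfl, analyticOrderAt_eq_top.2 (by simp)] at this
    exact ENat.top_ne_natCast _ this
  rw [zeroCount, if_neg hne]
  have hset : {x : ℂ × ℕ | x.1 ∈ nonreal ∧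
      (x.2 : ℕ∞) < analyticOrderAt (fun z => aeval z p * G z) x.1}
      = ((R.filter (· ∈ nonreal)).toEnumFinset : Set (ℂ × ℕ)) := by
    ext ⟨z, k⟩
    simp only [Set.mem_ofPred_eq, Finset.mem_coe, Multiset.mem_toEnumFinset]
    by_cases hz : z ∈ nonreal
    · rw [hord z hz, Multiset.count_filter_of_pos hz]
      simp [hz]
    · rw [Multiset.count_filter_of_neg hz]
      simp [hz]
  rw [hset, Set.encard_coe_eq_coe_finsetCard, Multiset.card_toEnumFinset]
  obtain ⟨s, q, h, hs, hq, hqr⟩ := exists_splits_mul p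
  have hsq : s * q ≠ 0 := h ▸ hp
  have hs0 := left_ne_zero_of_mul hsq
  have hq0 := right_ne_zero_of_mul hsq
  have e : R = s.roots.map (algebraMap ℝ ℂ) + (q.map (algebraMap ℝ ℂ)).roots := by
    rw [hR, h, Polynomial.map_mul, roots_mul (by simpa using hsq), hs.roots_map]
  have e1 : (s.roots.map (algebraMap ℝ ℂ)).filter (· ∈ nonreal) = 0 := by
    rw [Multiset.filter_eq_nil]
    intro a ha
    obtain ⟨b, -, rfl⟩ := Multiset.mem_map.1 ha
    exact fun hb => hb ⟨b, rfl⟩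
  have e2 : ((q.map (algebraMap ℝ ℂ)).roots).filter (· ∈ nonreal)
      = (q.map (algebraMap ℝ ℂ)).roots := by
    rw [Multiset.filter_eq_self]
    rintro a ha ⟨b, rfl⟩
    have h1 : eval (algebraMap ℝ ℂ b) (q.map (algebraMap ℝ ℂ)) = 0 := (mem_roots'.1 ha).2
    rw [eval_map_apply] at h1
    have h2 : b ∈ q.roots := mem_roots'.2 ⟨hq0, by simpa using h1⟩
    simp [hqr] at h2
  rw [e, Multiset.filter_add, e1, e2, zero_add, ← hq,
    ← (IsAlgClosed.splits (q.map (algebraMap ℝ ℂ))).natDegree_eq_card_roots, natDegree_map]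

theorem zeroCount_aeval (p : ℝ[X]) :
    zeroCount (fun z : ℂ => aeval z p) nonreal = nonrealDegree p := by
  rcases eq_or_ne p 0 with rfl | hp
  · have : (fun z : ℂ => aeval z (0 : ℝ[X])) = 0 := by ext; simp
    rw [zeroCount, if_pos this]; simp
  · simpa using zeroCount_aeval_mul hp (G := fun _ => 1) (differentiable_const _) (by simp)

end LaguerrePolya

/-! ### Algebra of Appell polynomials -/

namespace LaguerrePolya

open Polynomial Filter Topology

theorem coeff_appell (f : PowerSeries ℝ) (n j : ℕ) :
    (appell f n).coeff j =
      if j ≤ n then (n.factorial : ℝ) / j.factorial * PowerSeries.coeff (n - j) f else 0 := by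
  rw [appell, finsetSum_coeff]
  simp only [coeff_C_mul, coeff_X_pow]
  split_ifs with h
  · rw [Finset.sum_eq_single (n - j)]
    · rw [if_pos (by omega), Nat.sub_sub_self h, mul_one]
    · intro k hk hkj
      rw [Finset.mem_range] at hk
      rw [if_neg (by omega), mul_zero]
    · intro hk
      rw [Finset.mem_range] at hk
      omega
  · refine Finset.sum_eq_zero fun k hk => ?_
    rw [if_neg (by omega), mul_zero]

theorem natDegree_appell_le (f : PowerSeries ℝ) (n : ℕ) : (appell f n).natDegree ≤ n := by
  rw [natDegree_le_iff_coeff_eq_zero]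
  intro j hj
  rw [coeff_appell, if_neg (by omega)]

theorem derivative_appell_succ (f : PowerSeries ℝ) (n : ℕ) :
    derivative (appell f (n + 1)) = C ((n : ℝ) + 1) * appell f n := by
  ext j
  rw [coeff_derivative, coeff_C_mul, coeff_appell, coeff_appell]
  by_cases h : j ≤ n
  · rw [if_pos h, if_pos (by omega), Nat.succ_sub_succ, Nat.factorial_succ, Nat.factorial_succ]
    have : (j.factorial : ℝ) ≠ 0 := by positivity
    push_cast
    field_simp
  · rw [if_neg h, if_neg (by omega)]
    simp

theorem appellNonrealZeros_eq (f : PowerSeries ℝ) (n : ℕ) :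
    appellNonrealZeros f n = nonrealDegree (appell f n) :=
  zeroCount_aeval _

theorem nonrealDegree_appell_le_succ (f : PowerSeries ℝ) (n : ℕ) :
    nonrealDegree (appell f n) ≤ nonrealDegree (appell f (n + 1)) := by
  have h := nonrealDegree_derivative_le (appell f (n + 1))
  rwa [derivative_appell_succ, nonrealDegree_C_mul (by positivity)] at h

theorem nonrealDegree_eq_zero_of_natDegree_le_one {p : ℝ[X]} (hp : p.natDegree ≤ 1) :
    nonrealDegree p = 0 := by
  have := (Splits.of_natDegree_le_one hp).natDegree_eq_card_roots
  rw [nonrealDegree, this, Nat.sub_self]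

/-- A factor `c z^m` only shifts the index and rescales, which permits the normalization to constant
coefficient `1`. -/
theorem appell_C_mul_X_pow_mul (c : ℝ) (m : ℕ) (h : PowerSeries ℝ) (n : ℕ) :
    appell (PowerSeries.C c * PowerSeries.X ^ m * h) (n + m)
      = C (c * ((n + m).factorial / n.factorial)) * appell h n := by
  ext j
  rw [coeff_C_mul, coeff_appell, coeff_appell, mul_assoc, PowerSeries.coeff_C_mul,
    PowerSeries.coeff_X_pow_mul']
  by_cases hj : j ≤ n
  · rw [if_pos (by omega), if_pos (by omega), if_pos hj, show n + m - j - m = n - j by omega]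
    have : (n.factorial : ℝ) ≠ 0 := by positivity
    field_simp
  · rw [if_neg hj, mul_zero]
    by_cases hj' : j ≤ n + m
    · rw [if_neg (show ¬ m ≤ n + m - j by omega), mul_zero, mul_zero, ite_self]
    · rw [if_neg hj']

theorem appell_eq_zero_of_lt (c : ℝ) (h : PowerSeries ℝ) {m n : ℕ} (hn : n < m) :
    appell (PowerSeries.C c * PowerSeries.X ^ m * h) n = 0 := by
  ext j
  rw [coeff_appell, mul_assoc, PowerSeries.coeff_C_mul, PowerSeries.coeff_X_pow_mul',
    if_neg (show ¬ m ≤ n - j by omega)]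
  simp

theorem nonrealDegree_appell_shift {c : ℝ} (hc : c ≠ 0) (m : ℕ) (h : PowerSeries ℝ) (n : ℕ) :
    nonrealDegree (appell (PowerSeries.C c * PowerSeries.X ^ m * h) (n + m))
      = nonrealDegree (appell h n) := by
  rw [appell_C_mul_X_pow_mul, nonrealDegree_C_mul]
  positivity

theorem exists_eq_C_mul_X_pow_mul {f : PowerSeries ℝ} (hf : f ≠ 0) :
    ∃ (c : ℝ) (m : ℕ) (h : PowerSeries ℝ), c ≠ 0 ∧ PowerSeries.constantCoeff h = 1 ∧
      f = PowerSeries.C c * PowerSeries.X ^ m * h := by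
  have h1 := PowerSeries.X_pow_order_mul_divXPowOrder (f := f)
  set g := f.divXPowOrder
  have h2 : PowerSeries.constantCoeff g ≠ 0 := by
    rw [PowerSeries.constantCoeff_divXPowOrder]; exact PowerSeries.coeff_order hf
  refine ⟨PowerSeries.constantCoeff g, f.order.toNat,
    PowerSeries.C (PowerSeries.constantCoeff g)⁻¹ * g, h2, ?_, ?_⟩
  · simp [h2]
  · nth_rw 1 [← h1]
    have : PowerSeries.C (PowerSeries.constantCoeff g) *
        PowerSeries.C (PowerSeries.constantCoeff g)⁻¹ = (1 : PowerSeries ℝ) := by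
      rw [← map_mul, mul_inv_cancel₀ h2, map_one]
    linear_combination (-(PowerSeries.X ^ f.order.toNat * g)) * this

end LaguerrePolya

/-! ### Power sums of a formal power series and Newton's identities -/

namespace LaguerrePolya

open Filter Topology
open scoped PowerSeries.WithPiTopology

section PowerSums

open PowerSeries

variable {K : Type*} [Field K]

/-- The power series `-X f' / f`. If `f = ∏ (1 - b_j X)` then its `k`-th coefficient is
the power sum `∑ b_j ^ k` for `k ≥ 1`. -/
noncomputable def powerSums (f : K⟦X⟧) : K⟦X⟧ := -(X * derivative K f * f⁻¹)

theorem powerSums_spec {f : K⟦X⟧} (hf : constantCoeff f = 1) :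
    X * derivative K f = -(f * powerSums f) := by
  have h : f * f⁻¹ = 1 := PowerSeries.mul_inv_cancel f (by simp [hf])
  rw [powerSums]
  linear_combination (-(X * derivative K f)) * h

theorem powerSums_eq {f S : K⟦X⟧} (hf : constantCoeff f = 1)
    (h : X * derivative K f = -(f * S)) : powerSums f = S := by
  have h1 : f * f⁻¹ = 1 := PowerSeries.mul_inv_cancel f (by simp [hf])
  rw [powerSums, h]
  linear_combination S * h1

theorem coeff_zero_powerSums (f : K⟦X⟧) : coeff 0 (powerSums f) = 0 := by
  simp [powerSums, mul_assoc]

theorem powerSums_one : powerSums (1 : K⟦X⟧) = 0 := by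
  simp [powerSums]

theorem powerSums_mul {f g : K⟦X⟧} (hf : constantCoeff f = 1) (hg : constantCoeff g = 1) :
    powerSums (f * g) = powerSums f + powerSums g := by
  refine powerSums_eq (by simp [hf, hg]) ?_
  rw [Derivation.leibniz]
  simp only [smul_eq_mul]
  linear_combination f * powerSums_spec hg + g * powerSums_spec hf

theorem constantCoeff_prod {ι : Type*} (s : Finset ι) {f : ι → K⟦X⟧}
    (hf : ∀ i ∈ s, constantCoeff (f i) = 1) : constantCoeff (∏ i ∈ s, f i) = 1 := by
  rw [map_prod]
  exact Finset.prod_eq_one hf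

theorem powerSums_prod {ι : Type*} (s : Finset ι) {f : ι → K⟦X⟧}
    (hf : ∀ i, constantCoeff (f i) = 1) :
    powerSums (∏ i ∈ s, f i) = ∑ i ∈ s, powerSums (f i) := by
  classical
  induction s using Finset.induction_on with
  | empty => simpa using powerSums_one
  | insert a s ha ih =>
    rw [Finset.prod_insert ha, Finset.sum_insert ha,
      powerSums_mul (hf a) (constantCoeff_prod s fun i _ => hf i), ih]

theorem powerSums_pow {f : K⟦X⟧} (hf : constantCoeff f = 1) (n : ℕ) :
    powerSums (f ^ n) = n • powerSums f := by
  have := powerSums_prod (Finset.range n) (f := fun _ => f) fun _ => hf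
  simpa using this

theorem powerSums_map {L : Type*} [Field L] (φ : K →+* L) {f : K⟦X⟧}
    (hf : constantCoeff f = 1) : powerSums (PowerSeries.map φ f) = PowerSeries.map φ (powerSums f) := by
  have h1 : constantCoeff (PowerSeries.map φ f) = 1 := by
    rw [← coeff_zero_eq_constantCoeff_apply, coeff_map, coeff_zero_eq_constantCoeff_apply, hf,
      map_one]
  refine powerSums_eq h1 ?_
  have h := congrArg (PowerSeries.map φ) (powerSums_spec hf)
  rw [map_mul, map_neg, map_mul, map_X] at h
  rw [← h]
  congr 1
  ext n
  simp [coeff_derivative]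

theorem constantCoeff_one_sub (b : K) : constantCoeff (1 - C b * X : K⟦X⟧) = 1 := by simp

theorem powerSums_one_sub (b : K) :
    powerSums (1 - C b * X) = mk fun k => if k = 0 then 0 else b ^ k := by
  refine powerSums_eq (constantCoeff_one_sub b) ?_
  have hd : derivative K (1 - C b * X) = -C b := by
    rw [map_sub, derivative_one, Derivation.leibniz, derivative_X, derivative_C]
    simp
  rw [hd]
  ext k
  rcases k with _ | k
  · simp
  · rw [sub_mul, one_mul, mul_assoc, map_neg, map_sub, coeff_C_mul, coeff_succ_X_mul,
      coeff_succ_X_mul, coeff_mk, coeff_mk, map_neg, coeff_C]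
    rcases k with _ | k
    · simp
    · simp [pow_succ']

/-- Newton's identities. They are triangular, so power sums are polynomial in the coefficients and,
in characteristic zero, conversely. Convergence therefore transfers both ways, and power sums
determine a series with constant coefficient `1`. -/
theorem coeff_succ_mul_eq_powerSums {f : K⟦X⟧} (hf : constantCoeff f = 1) (k : ℕ) :
    coeff (k + 1) f * (k + 1) =
      -∑ i ∈ Finset.range (k + 1), coeff i f * coeff (k + 1 - i) (powerSums f) := by
  have h := congrArg (coeff (k + 1)) (powerSums_spec hf)
  rw [coeff_succ_X_mul, coeff_derivative, map_neg, coeff_mul,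
    Finset.Nat.sum_antidiagonal_eq_sum_range_succ_mk, Finset.sum_range_succ] at h
  rw [h]
  simp only [Nat.sub_self, coeff_zero_powerSums, mul_zero, add_zero]

theorem coeff_succ_powerSums {f : K⟦X⟧} (hf : constantCoeff f = 1) (k : ℕ) :
    coeff (k + 1) (powerSums f) = -(coeff (k + 1) f * (k + 1))
      - ∑ i ∈ Finset.range k, coeff (i + 1) f * coeff (k - i) (powerSums f) := by
  have h := coeff_succ_mul_eq_powerSums hf k
  rw [Finset.sum_range_succ'] at h
  simp only [Nat.add_sub_add_right, Nat.sub_zero, coeff_zero_eq_constantCoeff_apply, hf] at h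
  rw [h]
  ring

theorem tendsto_powerSums [TopologicalSpace K] [IsTopologicalRing K] {ι : Type*} {l : Filter ι}
    {f : ι → K⟦X⟧} {g : K⟦X⟧} (hf : ∀ i, constantCoeff (f i) = 1) (hg : constantCoeff g = 1)
    (h : Tendsto f l (𝓝 g)) : Tendsto (fun i => powerSums (f i)) l (𝓝 (powerSums g)) := by
  rw [PowerSeries.WithPiTopology.tendsto_iff_coeff_tendsto] at h ⊢
  intro k
  induction k using Nat.strong_induction_on with
  | _ k ih =>
    rcases k with _ | k
    · simp only [coeff_zero_powerSums]; exact tendsto_const_nhds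
    · simp only [coeff_succ_powerSums hg, coeff_succ_powerSums (hf _)]
      refine ((h (k + 1)).mul_const _).neg.sub (tendsto_finsetSum _ fun i hi => ?_)
      exact (h (i + 1)).mul (ih _ (by omega))

theorem tendsto_of_tendsto_powerSums [CharZero K] [TopologicalSpace K] [IsTopologicalRing K]
    {ι : Type*} {l : Filter ι} {f : ι → K⟦X⟧} {g : K⟦X⟧} (hf : ∀ i, constantCoeff (f i) = 1)
    (hg : constantCoeff g = 1)
    (h : Tendsto (fun i => powerSums (f i)) l (𝓝 (powerSums g))) : Tendsto f l (𝓝 g) := by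
  have key : ∀ (p : K⟦X⟧), constantCoeff p = 1 → ∀ k, coeff (k + 1) p =
      (-∑ i ∈ Finset.range (k + 1), coeff i p * coeff (k + 1 - i) (powerSums p)) *
        ((k : K) + 1)⁻¹ := by
    intro p hp k
    rw [← coeff_succ_mul_eq_powerSums hp, mul_assoc,
      mul_inv_cancel₀ (by exact_mod_cast k.succ_ne_zero),
      mul_one]
  rw [PowerSeries.WithPiTopology.tendsto_iff_coeff_tendsto] at h ⊢
  intro k
  induction k using Nat.strong_induction_on with
  | _ k ih =>
    rcases k with _ | k
    · simp only [coeff_zero_eq_constantCoeff_apply, hf, hg]; exact tendsto_const_nhds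
    · simp only [key g hg, key _ (hf _)]
      refine (tendsto_finsetSum _ fun i hi => ?_).neg.mul_const _
      exact (ih i (Finset.mem_range.1 hi)).mul (h _)

theorem powerSums_injective [CharZero K] {f g : K⟦X⟧} (hf : constantCoeff f = 1)
    (hg : constantCoeff g = 1) (h : powerSums f = powerSums g) : f = g := by
  ext k
  induction k using Nat.strong_induction_on with
  | _ k ih =>
    rcases k with _ | k
    · simp [hf, hg]
    · have h1 := coeff_succ_mul_eq_powerSums hf k
      rw [h, Finset.sum_congr rfl fun i hi => by rw [ih i (Finset.mem_range.1 hi)],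
        ← coeff_succ_mul_eq_powerSums hg k] at h1
      exact mul_right_cancel₀ (by exact_mod_cast k.succ_ne_zero) h1

end PowerSums

end LaguerrePolya

/-! ### Entire functions and their real power series -/

namespace LaguerrePolya

open Filter Topology
open scoped PowerSeries.WithPiTopology

theorem hasFPowerSeriesOnBall_of_hasSum {a : ℕ → ℂ} {F : ℂ → ℂ}
    (h : ∀ z, HasSum (fun k => a k * z ^ k) (F z)) :
    HasFPowerSeriesOnBall F (FormalMultilinearSeries.ofScalars ℂ a) 0 ⊤ := by
  have hr : (FormalMultilinearSeries.ofScalars ℂ a).radius = ⊤ := by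
    refine FormalMultilinearSeries.radius_eq_top_of_summable_norm _ fun r => ?_
    refine (h (r : ℝ)).summable.norm.congr fun k => ?_
    rw [FormalMultilinearSeries.ofScalars_norm]
    simp
  refine ⟨hr.ge, by simp, fun {y} _ => ?_⟩
  simpa [FormalMultilinearSeries.ofScalars_apply_eq, mul_comm] using h y

theorem eq_of_hasSum {a b : ℕ → ℂ} {F : ℂ → ℂ}
    (ha : ∀ z, HasSum (fun k => a k * z ^ k) (F z))
    (hb : ∀ z, HasSum (fun k => b k * z ^ k) (F z)) : a = b := by
  have := (hasFPowerSeriesOnBall_of_hasSum ha).hasFPowerSeriesAt.eq_formalMultilinearSeries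
    (hasFPowerSeriesOnBall_of_hasSum hb).hasFPowerSeriesAt
  exact FormalMultilinearSeries.ofScalars_series_injective ℂ ℂ this

theorem Represents.differentiable {f : PowerSeries ℝ} {F : ℂ → ℂ} (h : Represents f F) :
    Differentiable ℂ F := by
  rw [← differentiableOn_univ]
  simpa using (hasFPowerSeriesOnBall_of_hasSum h).differentiableOn

theorem Represents.unique_left {f g : PowerSeries ℝ} {F : ℂ → ℂ} (hf : Represents f F)
    (hg : Represents g F) : f = g := by
  have := eq_of_hasSum hf hg
  ext k
  exact_mod_cast congrFun this k

theorem Represents.unique_right {f : PowerSeries ℝ} {F G : ℂ → ℂ} (hF : Represents f F)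
    (hG : Represents f G) : F = G :=
  funext fun z => (hF z).unique (hG z)

theorem hasSum_iteratedDeriv {F : ℂ → ℂ} (hF : Differentiable ℂ F) (z : ℂ) :
    HasSum (fun k : ℕ => ((k.factorial : ℂ)⁻¹ * iteratedDeriv k F 0) * z ^ k) (F z) := by
  convert! Complex.hasSum_taylorSeries_of_entire hF 0 z using 2 with k
  simp only [sub_zero, smul_eq_mul]
  ring

theorem Represents.coeff_eq {f : PowerSeries ℝ} {F : ℂ → ℂ} (h : Represents f F) (k : ℕ) :
    ((PowerSeries.coeff k f : ℝ) : ℂ) = (k.factorial : ℂ)⁻¹ * iteratedDeriv k F 0 :=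
  congrFun (eq_of_hasSum h (hasSum_iteratedDeriv h.differentiable)) k

theorem Represents.isRealEntire {f : PowerSeries ℝ} {F : ℂ → ℂ} (h : Represents f F) :
    IsRealEntire F := by
  refine ⟨h.differentiable, fun x => ⟨(F x).re, ?_⟩⟩
  have h1 : HasSum (fun _ : ℕ => (0 : ℝ)) (F x).im := by
    convert! Complex.hasSum_im (h x) using 2 with k
    rw [← Complex.ofReal_pow, ← Complex.ofReal_mul, Complex.ofReal_im]
  apply Complex.ext
  · simp
  · simpa using (hasSum_zero.unique h1).symm

theorem Represents.mul {f g : PowerSeries ℝ} {F G : ℂ → ℂ} (hf : Represents f F)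
    (hg : Represents g G) : Represents (f * g) (fun z => F z * G z) := by
  intro z
  have h1 := (hf z).summable.norm
  have h2 := (hg z).summable.norm
  have h3 := tsum_mul_tsum_eq_tsum_sum_antidiagonal_of_summable_norm h1 h2
  have h4 := (summable_norm_sum_mul_antidiagonal_of_summable_norm h1 h2).of_norm
  rw [(hf z).tsum_eq, (hg z).tsum_eq] at h3
  show HasSum _ (F z * G z)
  rw [h3]
  convert! h4.hasSum using 2 with k
  rw [PowerSeries.coeff_mul]
  push_cast
  rw [Finset.sum_mul]
  refine Finset.sum_congr rfl fun x hx => ?_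
  rw [← Finset.HasAntidiagonal.mem_antidiagonal.1 hx, pow_add]
  ring

theorem represents_polynomial (p : Polynomial ℝ) :
    Represents (p : PowerSeries ℝ) (fun z => Polynomial.aeval z p) := by
  intro z
  have : Polynomial.aeval z p = ∑ k ∈ Finset.range (p.natDegree + 1),
      ((PowerSeries.coeff k (p : PowerSeries ℝ) : ℝ) : ℂ) * z ^ k := by
    rw [Polynomial.aeval_eq_sum_range]
    simp [Algebra.smul_def]
  show HasSum _ (Polynomial.aeval z p)
  rw [this]
  refine hasSum_sum_of_ne_finset_zero fun k hk => ?_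
  rw [Polynomial.coeff_coe, Polynomial.coeff_eq_zero_of_natDegree_lt]
  · simp
  · simpa using hk

theorem represents_one : Represents 1 (fun _ => 1) := by
  simpa using represents_polynomial 1

theorem represents_prod {ι : Type*} (s : Finset ι) {f : ι → PowerSeries ℝ} {F : ι → ℂ → ℂ}
    (h : ∀ i, Represents (f i) (F i)) :
    Represents (∏ i ∈ s, f i) (fun z => ∏ i ∈ s, F i z) := by
  classical
  induction s using Finset.induction_on with
  | empty => simpa using represents_one
  | insert a s ha ih =>
    simp only [Finset.prod_insert ha]
    exact (h a).mul ih

theorem tendstoLocallyUniformlyOn_iteratedDeriv {ι : Type*} {l : Filter ι} {F : ι → ℂ → ℂ}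
    {G : ℂ → ℂ} (hF : ∀ i, Differentiable ℂ (F i))
    (h : TendstoLocallyUniformlyOn F G l Set.univ) (k : ℕ) :
    TendstoLocallyUniformlyOn (fun i => iteratedDeriv k (F i)) (iteratedDeriv k G) l
      Set.univ := by
  induction k with
  | zero => simpa using h
  | succ k ih =>
    simp only [iteratedDeriv_succ]
    refine ih.deriv (Eventually.of_forall fun i => ?_) isOpen_univ
    exact (((hF i).contDiff (n := ((k + 1 : ℕ) : WithTop ℕ∞))).differentiable_iteratedDeriv k
      (by exact_mod_cast k.lt_succ_self)).differentiableOn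

/-- Weierstrass: derivatives at `0` converge too, so Taylor coefficients converge, and limits of
real coefficients are real. -/
theorem exists_represents_of_tendstoLocallyUniformlyOn {ι : Type*} {l : Filter ι} [l.NeBot]
    {f : ι → PowerSeries ℝ} {F : ι → ℂ → ℂ} {G : ℂ → ℂ} (hF : ∀ i, Represents (f i) (F i))
    (h : TendstoLocallyUniformlyOn F G l Set.univ) :
    ∃ g, Represents g G ∧ Tendsto f l (𝓝 g) := by
  have hd : ∀ i, Differentiable ℂ (F i) := fun i => (hF i).differentiable
  have hG : Differentiable ℂ G := by
    rw [← differentiableOn_univ]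
    exact h.differentiableOn (Eventually.of_forall fun i => (hd i).differentiableOn) isOpen_univ
  set c : ℕ → ℂ := fun k => (k.factorial : ℂ)⁻¹ * iteratedDeriv k G 0 with hc
  have hlim : ∀ k, Tendsto (fun i => ((PowerSeries.coeff k (f i) : ℝ) : ℂ)) l (𝓝 (c k)) := by
    intro k
    simp only [(hF _).coeff_eq]
    exact ((tendstoLocallyUniformlyOn_iteratedDeriv hd h k).tendsto_at
      (Set.mem_univ 0)).const_mul _
  have hre : ∀ k, Tendsto (fun i => PowerSeries.coeff k (f i)) l (𝓝 (c k).re) := fun k => by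
    simpa [Function.comp_def] using (Complex.continuous_re.tendsto _).comp (hlim k)
  have him : ∀ k, (((c k).re : ℝ) : ℂ) = c k := fun k => by
    have h2 := (Complex.continuous_im.tendsto _).comp (hlim k)
    have h3 : (c k).im = 0 := tendsto_nhds_unique h2 (by simp [Function.comp_def])
    apply Complex.ext <;> simp [h3]
  refine ⟨PowerSeries.mk fun k => (c k).re, fun z => ?_, ?_⟩
  · simp only [PowerSeries.coeff_mk, him]
    exact hasSum_iteratedDeriv hG z
  · rw [PowerSeries.WithPiTopology.tendsto_iff_coeff_tendsto]
    intro k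
    simpa using hre k

/-- The power series of `exp (b z)`. -/
noncomputable def expSeries (b : ℝ) : PowerSeries ℝ := PowerSeries.mk fun k => b ^ k / k.factorial

theorem constantCoeff_expSeries (b : ℝ) : PowerSeries.constantCoeff (expSeries b) = 1 := by
  rw [← PowerSeries.coeff_zero_eq_constantCoeff_apply, expSeries, PowerSeries.coeff_mk]
  simp

theorem represents_expSeries (b : ℝ) : Represents (expSeries b) (fun z => Complex.exp (b * z)) := by
  intro z
  have := NormedSpace.exp_series_hasSum_exp' (𝕂 := ℂ) ((b : ℂ) * z)
  rw [← Complex.exp_eq_exp_ℂ] at this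
  convert! this using 2 with k
  rw [expSeries, PowerSeries.coeff_mk, smul_eq_mul, mul_pow]
  push_cast
  ring

theorem powerSums_expSeries (b : ℝ) :
    powerSums (expSeries b) = PowerSeries.C (-b) * PowerSeries.X := by
  refine powerSums_eq (constantCoeff_expSeries b) ?_
  ext k
  rw [← mul_assoc, map_neg]
  rcases k with _ | k
  · simp
  · rw [PowerSeries.coeff_succ_X_mul, PowerSeries.coeff_succ_mul_X, PowerSeries.coeff_derivative,
      PowerSeries.coeff_mul_C, expSeries, PowerSeries.coeff_mk, PowerSeries.coeff_mk,
      Nat.factorial_succ]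
    have : (k.factorial : ℝ) ≠ 0 := by positivity
    push_cast
    field_simp
    ring

/-- The power series of `exp (-α z ^ 2)`. -/
noncomputable def gaussSeries (α : ℝ) : PowerSeries ℝ :=
  PowerSeries.mk fun k => if Even k then (-α) ^ (k / 2) / (k / 2).factorial else 0

theorem constantCoeff_gaussSeries (α : ℝ) : PowerSeries.constantCoeff (gaussSeries α) = 1 := by
  rw [← PowerSeries.coeff_zero_eq_constantCoeff_apply, gaussSeries, PowerSeries.coeff_mk]
  simp

theorem represents_gaussSeries (α : ℝ) :
    Represents (gaussSeries α) (fun z => Complex.exp (-α * z ^ 2)) := by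
  intro z
  have := NormedSpace.exp_series_hasSum_exp' (𝕂 := ℂ) (-(α : ℂ) * z ^ 2)
  rw [← Complex.exp_eq_exp_ℂ] at this
  show HasSum _ (Complex.exp (-α * z ^ 2))
  rw [← add_zero (Complex.exp (-α * z ^ 2))]
  refine HasSum.even_add_odd ?_ ?_
  · convert! this using 2 with k
    rw [gaussSeries, PowerSeries.coeff_mk, smul_eq_mul, mul_pow, if_pos (even_two_mul k),
      Nat.mul_div_cancel_left k two_pos, pow_mul]
    push_cast
    ring
  · convert! hasSum_zero using 2 with k
    rw [gaussSeries, PowerSeries.coeff_mk, if_neg (by simp)]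
    simp

theorem powerSums_gaussSeries (α : ℝ) :
    powerSums (gaussSeries α) = PowerSeries.C (2 * α) * PowerSeries.X ^ 2 := by
  refine powerSums_eq (constantCoeff_gaussSeries α) ?_
  have : PowerSeries.derivative ℝ (gaussSeries α)
      = -(gaussSeries α * PowerSeries.C (2 * α) * PowerSeries.X) := by
    ext k
    rw [map_neg]
    rcases k with _ | k
    · simp [PowerSeries.coeff_derivative, gaussSeries]
    · rw [PowerSeries.coeff_succ_mul_X, PowerSeries.coeff_derivative,
        PowerSeries.coeff_mul_C, gaussSeries, PowerSeries.coeff_mk, PowerSeries.coeff_mk]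
      by_cases hk : Even k
      · obtain ⟨i, rfl⟩ := hk
        rw [if_pos (show Even (i + i + 1 + 1) from ⟨i + 1, by ring⟩), if_pos ⟨i, rfl⟩,
          show (i + i + 1 + 1) / 2 = i + 1 by omega,
          show (i + i) / 2 = i by omega, Nat.factorial_succ]
        have : (i.factorial : ℝ) ≠ 0 := by positivity
        push_cast
        field_simp
        ring
      · rw [if_neg (show ¬ Even (k + 1 + 1) by simpa [Nat.even_add_one] using hk), if_neg hk]
        simp
  rw [this]
  ring

end LaguerrePolya

/-! ### Genus one products and limits of polynomials -/

namespace LaguerrePolya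

open Filter Topology
open scoped PowerSeries.WithPiTopology

theorem norm_one_sub_mul_exp_sub_one_le {w : ℂ} (hw : ‖w‖ ≤ 1) :
    ‖(1 - w) * Complex.exp w - 1‖ ≤ 3 * ‖w‖ ^ 2 := by
  have h1 := Complex.norm_exp_sub_one_sub_id_le hw
  have h2 := Complex.norm_exp_sub_one_le hw
  -- Cancels the linear term. The constant `3` is `1` from the second-order bound on `exp` plus `2`
  -- from the first-order one.
  have h3 : (1 - w) * Complex.exp w - 1 = (Complex.exp w - 1 - w) - w * (Complex.exp w - 1) := by
    ring
  rw [h3]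
  refine (norm_sub_le _ _).trans ?_
  rw [norm_mul]
  nlinarith [mul_le_mul_of_nonneg_left h2 (norm_nonneg w)]

/-- The genus one factor `(1 - b z) exp (b z)`. -/
noncomputable def primaryFactor (b : ℝ) (z : ℂ) : ℂ := (1 - b * z) * Complex.exp (b * z)

/-- The power series of `(1 - b z) exp (b z)`. -/
noncomputable def primarySeries (b : ℝ) : PowerSeries ℝ :=
  (1 - PowerSeries.C b * PowerSeries.X) * expSeries b

theorem constantCoeff_primarySeries (b : ℝ) :
    PowerSeries.constantCoeff (primarySeries b) = 1 := by
  rw [primarySeries, map_mul, constantCoeff_expSeries, constantCoeff_one_sub, one_mul]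

/-- The exponential removes exactly the first power sum, so only square summability of the `b j` is
needed. -/
theorem coeff_powerSums_primarySeries (b : ℝ) (k : ℕ) :
    PowerSeries.coeff k (powerSums (primarySeries b)) = if k ≤ 1 then 0 else b ^ k := by
  rw [primarySeries, powerSums_mul (constantCoeff_one_sub b) (constantCoeff_expSeries b),
    powerSums_one_sub, powerSums_expSeries, map_add, PowerSeries.coeff_mk, PowerSeries.coeff_C_mul,
    PowerSeries.coeff_X]
  rcases k with _ | _ | k <;> simp

theorem one_sub_C_mul_X_eq_coe (b : ℝ) :
    (1 - PowerSeries.C b * PowerSeries.X : PowerSeries ℝ)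
      = ((1 - Polynomial.C b * Polynomial.X : Polynomial ℝ) : PowerSeries ℝ) := by
  simp

theorem represents_primarySeries (b : ℝ) : Represents (primarySeries b) (primaryFactor b) := by
  have h := represents_polynomial (1 - Polynomial.C b * Polynomial.X)
  rw [← one_sub_C_mul_X_eq_coe] at h
  simpa [primaryFactor] using! h.mul (represents_expSeries b)

theorem differentiable_primaryFactor (b : ℝ) : Differentiable ℂ (primaryFactor b) :=
  (represents_primarySeries b).differentiable

section Product

variable {ι : Type*} {b : ι → ℝ}

theorem eventually_norm_primaryFactor_sub_one_le (hb : Summable fun j => b j ^ 2) {R : ℝ} :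
    ∀ᶠ j in cofinite, ∀ z : ℂ, ‖z‖ ≤ R → ‖primaryFactor (b j) z - 1‖ ≤ 3 * R ^ 2 * b j ^ 2 := by
  have h1 : Tendsto (fun j => b j ^ 2 * R ^ 2) cofinite (𝓝 0) := by
    simpa using hb.tendsto_cofinite_zero.mul_const (R ^ 2)
  filter_upwards [h1.eventually (gt_mem_nhds one_pos)] with j hj z hz
  have h0 : ‖(b j : ℂ) * z‖ ^ 2 ≤ b j ^ 2 * R ^ 2 := by
    rw [norm_mul, mul_pow, Complex.norm_real, Real.norm_eq_abs, sq_abs]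
    gcongr
  have h2 : ‖(b j : ℂ) * z‖ ≤ 1 := by
    rw [← abs_norm, ← sq_le_one_iff_abs_le_one]
    exact h0.trans hj.le
  refine (norm_one_sub_mul_exp_sub_one_le h2).trans ?_
  linarith

theorem tendstoLocallyUniformlyOn_primaryFactor (hb : Summable fun j => b j ^ 2) :
    TendstoLocallyUniformlyOn (fun (s : Finset ι) z => ∏ j ∈ s, primaryFactor (b j) z)
      (fun z => ∏' j, primaryFactor (b j) z) atTop Set.univ := by
  rw [← hasProdLocallyUniformlyOn_iff_tendstoLocallyUniformlyOn]
  refine hasProdLocallyUniformlyOn_of_forall_compact isOpen_univ fun S _ hS => ?_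
  obtain ⟨R, hR⟩ := hS.isBounded.exists_norm_le
  have := Summable.hasProdUniformlyOn_one_add (f := fun j z => primaryFactor (b j) z - 1) hS
    (hb.mul_left (3 * R ^ 2))
    ((eventually_norm_primaryFactor_sub_one_le hb (R := R)).mono fun j hj z hz => hj z (hR z hz))
    fun j => ((differentiable_primaryFactor (b j)).continuous.sub continuous_const).continuousOn
  simpa using this

theorem summable_norm_primaryFactor_sub_one (hb : Summable fun j => b j ^ 2) (z : ℂ) :
    Summable fun j => ‖primaryFactor (b j) z - 1‖ := by
  refine (hb.mul_left (3 * ‖z‖ ^ 2)).of_norm_bounded_eventually ?_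
  filter_upwards [eventually_norm_primaryFactor_sub_one_le hb (R := ‖z‖)] with j hj
  simpa using hj z le_rfl

theorem hasProd_primaryFactor (hb : Summable fun j => b j ^ 2) (z : ℂ) :
    HasProd (fun j => primaryFactor (b j) z) (∏' j, primaryFactor (b j) z) := by
  have := multipliable_one_add_of_summable (summable_norm_primaryFactor_sub_one hb z)
  simpa using this.hasProd

theorem primaryFactor_ne_zero (b : ℝ) {z : ℂ} (hz : z ∈ nonreal) : primaryFactor b z ≠ 0 := by
  refine mul_ne_zero (fun h => hz ?_) (Complex.exp_ne_zero _)
  have hb : b ≠ 0 := by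
    rintro rfl
    simp at h
  refine ⟨b⁻¹, ?_⟩
  have : (b : ℂ) ≠ 0 := by exact_mod_cast hb
  push_cast
  field_simp
  linear_combination h

theorem tprod_primaryFactor_ne_zero (hb : Summable fun j => b j ^ 2) {z : ℂ} (hz : z ∈ nonreal) :
    ∏' j, primaryFactor (b j) z ≠ 0 := by
  have := tprod_one_add_ne_zero_of_summable (f := fun j => primaryFactor (b j) z - 1)
    (fun j => by simpa using primaryFactor_ne_zero (b j) hz)
    (summable_norm_primaryFactor_sub_one hb z)
  simpa using this

/-- Finite partial products converge locally uniformly, hence coefficientwise. Continuity of power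
sums turns this into convergence of the sums `∑ b j ^ k`. -/
theorem exists_represents_tprod_primaryFactor (hb : Summable fun j => b j ^ 2) :
    ∃ f : PowerSeries ℝ, Represents f (fun z => ∏' j, primaryFactor (b j) z) ∧
      PowerSeries.constantCoeff f = 1 ∧
      Tendsto (fun s : Finset ι => ∏ j ∈ s, primarySeries (b j)) atTop (𝓝 f) ∧
      ∀ k, HasSum (fun j => if k ≤ 1 then 0 else b j ^ k) (PowerSeries.coeff k (powerSums f)) := by
  obtain ⟨f, hf, hlim⟩ := exists_represents_of_tendstoLocallyUniformlyOn
    (fun s : Finset ι => represents_prod s fun j => represents_primarySeries (b j))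
    (tendstoLocallyUniformlyOn_primaryFactor hb)
  have h1 : ∀ s : Finset ι, PowerSeries.constantCoeff (∏ j ∈ s, primarySeries (b j)) = 1 :=
    fun s => constantCoeff_prod s fun j _ => constantCoeff_primarySeries (b j)
  have h2 : PowerSeries.constantCoeff f = 1 := by
    have := ((PowerSeries.WithPiTopology.continuous_constantCoeff ℝ).tendsto f).comp hlim
    simp only [Function.comp_def, h1] at this
    exact (tendsto_nhds_unique this tendsto_const_nhds)
  refine ⟨f, hf, h2, hlim, fun k => ?_⟩
  have h3 := tendsto_powerSums h1 h2 hlim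
  rw [PowerSeries.WithPiTopology.tendsto_iff_coeff_tendsto] at h3
  have h4 := h3 k
  simp only [powerSums_prod _ fun j => constantCoeff_primarySeries (b j), map_sum,
    coeff_powerSums_primarySeries] at h4
  exact h4

end Product

/-- The coefficientwise limits of real polynomials with constant coefficient `1` and
at most `M` non-real zeros. -/
def limitClass (M : ℕ) : Set (PowerSeries ℝ) :=
  closure {f | ∃ p : Polynomial ℝ, f = p ∧ p.coeff 0 = 1 ∧ nonrealDegree p ≤ M}

theorem coe_mem_limitClass {p : Polynomial ℝ} {M : ℕ} (h0 : p.coeff 0 = 1)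
    (h : nonrealDegree p ≤ M) : (p : PowerSeries ℝ) ∈ limitClass M :=
  subset_closure ⟨p, rfl, h0, h⟩

theorem nonrealDegree_mul_le (p q : Polynomial ℝ) :
    nonrealDegree (p * q) ≤ nonrealDegree p + nonrealDegree q := by
  obtain ⟨s, r, hp, hs, hr, -⟩ := exists_splits_mul p
  obtain ⟨s', r', hq, hs', hr', -⟩ := exists_splits_mul q
  have : p * q = (s * s') * (r * r') := by rw [hp, hq]; ring
  rw [this, ← hr, ← hr']
  exact (nonrealDegree_splits_mul_le (hs.mul hs') _).trans
    ((nonrealDegree_le_natDegree _).trans Polynomial.natDegree_mul_le)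

theorem limitClass_mul {M N : ℕ} {f g : PowerSeries ℝ} (hf : f ∈ limitClass M)
    (hg : g ∈ limitClass N) : f * g ∈ limitClass (M + N) := by
  refine map_mem_closure₂ continuous_mul hf hg ?_
  rintro _ ⟨p, rfl, hp, hp'⟩ _ ⟨q, rfl, hq, hq'⟩
  refine ⟨p * q, by simp, by simp [Polynomial.mul_coeff_zero, hp, hq], ?_⟩
  exact (nonrealDegree_mul_le p q).trans (by omega)

theorem limitClass_prod {ι : Type*} (s : Finset ι) {f : ι → PowerSeries ℝ}
    (h : ∀ i, f i ∈ limitClass 0) : ∏ i ∈ s, f i ∈ limitClass 0 := by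
  classical
  induction s using Finset.induction_on with
  | empty =>
    have := coe_mem_limitClass (p := 1) (M := 0) (by simp) (by simp [nonrealDegree])
    simpa using this
  | insert a s ha ih =>
    rw [Finset.prod_insert ha]
    exact limitClass_mul (h a) ih

theorem limitClass_pow {f : PowerSeries ℝ} (h : f ∈ limitClass 0) (n : ℕ) :
    f ^ n ∈ limitClass 0 := by
  have := limitClass_prod (Finset.range n) fun _ => h
  simpa using this

theorem one_sub_mem_limitClass (b : ℝ) :
    (1 - PowerSeries.C b * PowerSeries.X : PowerSeries ℝ) ∈ limitClass 0 := by
  rw [one_sub_C_mul_X_eq_coe]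
  refine coe_mem_limitClass (by simp) (nonrealDegree_eq_zero_of_natDegree_le_one ?_).le
  compute_degree

theorem limitClass_of_tendsto {ι : Type*} {l : Filter ι} [l.NeBot] {f : ι → PowerSeries ℝ}
    {g : PowerSeries ℝ} {M : ℕ} (hf : ∀ i, f i ∈ limitClass M) (h : Tendsto f l (𝓝 g)) :
    g ∈ limitClass M :=
  isClosed_closure.mem_of_tendsto h (Eventually.of_forall hf)

theorem constantCoeff_of_mem_limitClass {M : ℕ} {f : PowerSeries ℝ} (hf : f ∈ limitClass M) :
    PowerSeries.constantCoeff f = 1 := by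
  have hc : IsClosed {f : PowerSeries ℝ | PowerSeries.constantCoeff f = 1} :=
    isClosed_eq (PowerSeries.WithPiTopology.continuous_constantCoeff ℝ) continuous_const
  refine closure_minimal ?_ hc hf
  rintro _ ⟨p, rfl, hp, -⟩
  simpa using! hp

theorem tendsto_inv_succ_pow {k : ℕ} (hk : k ≠ 0) (c : ℝ) :
    Tendsto (fun n : ℕ => (c / ((n : ℝ) + 1)) ^ k) atTop (𝓝 0) := by
  have h : Tendsto (fun n : ℕ => c / ((n : ℝ) + 1)) atTop (𝓝 0) := by
    have := (tendsto_one_div_add_atTop_nhds_zero_nat (𝕜 := ℝ)).const_mul c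
    simpa [div_eq_mul_inv] using this
  simpa [hk] using h.pow k

/-- Limit of `(1 + bz/(n+1))^(n+1)`: the first power sum is always `-b`, and those of higher order
tend to `0`. -/
theorem expSeries_mem_limitClass (b : ℝ) : expSeries b ∈ limitClass 0 := by
  set f : ℕ → PowerSeries ℝ := fun n =>
    (1 - PowerSeries.C (-b / ((n : ℝ) + 1)) * PowerSeries.X) ^ (n + 1) with hfdef
  have hf0 : ∀ n, PowerSeries.constantCoeff (f n) = 1 := fun n => by simp [f]
  refine limitClass_of_tendsto (f := f) (l := atTop)
    (fun n => limitClass_pow (one_sub_mem_limitClass _) _) ?_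
  refine tendsto_of_tendsto_powerSums hf0 (constantCoeff_expSeries b) ?_
  rw [PowerSeries.WithPiTopology.tendsto_iff_coeff_tendsto]
  intro k
  have h1 : ∀ n, PowerSeries.coeff k (powerSums (f n))
      = (n + 1) * (if k = 0 then 0 else (-b / ((n : ℝ) + 1)) ^ k) := fun n => by
    simp only [hfdef]
    rw [powerSums_pow (constantCoeff_one_sub _), powerSums_one_sub, map_nsmul,
      PowerSeries.coeff_mk]
    simp
  simp only [h1, powerSums_expSeries, PowerSeries.coeff_C_mul, PowerSeries.coeff_X]
  have h2 : ∀ n : ℕ, ((n : ℝ) + 1) ≠ 0 := fun n => by positivity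
  rcases k with _ | _ | k
  · simp
  · simp [mul_div_cancel₀ _ (h2 _)]
  · have h3 := (tendsto_inv_succ_pow (k := k + 1) (by simp) (-b)).const_mul (-b)
    simp only [mul_zero] at h3
    simp only [Nat.add_eq_zero_iff, one_ne_zero, and_false, if_false]
    rw [if_neg (by omega), mul_zero]
    refine h3.congr fun n => ?_
    rw [pow_succ (-b / ((n : ℝ) + 1)) (k + 1)]
    have := h2 n
    field_simp

/-- Limit of `(1 - αz²/(n+1))^(n+1)`, whose zeros are real because `α ≥ 0`. The second power sum is
`2α` throughout, the odd ones vanish, and the higher even ones tend to `0`. -/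
theorem gaussSeries_mem_limitClass {α : ℝ} (hα : 0 ≤ α) : gaussSeries α ∈ limitClass 0 := by
  set x : ℕ → ℝ := fun n => √(α / ((n : ℝ) + 1)) with hx
  have hx2 : ∀ n : ℕ, ((n : ℝ) + 1) * x n ^ 2 = α := fun n => by
    have : ((n : ℝ) + 1) ≠ 0 := by positivity
    rw [hx, Real.sq_sqrt (by positivity)]
    field_simp
  have hx0 : Tendsto x atTop (𝓝 0) := by
    have h := tendsto_inv_succ_pow (k := 1) one_ne_zero α
    simp only [pow_one] at h
    simpa [Function.comp_def] using (Real.continuous_sqrt.tendsto 0).comp h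
  set f : ℕ → PowerSeries ℝ := fun n =>
    ((1 - PowerSeries.C (x n) * PowerSeries.X) * (1 - PowerSeries.C (-x n) * PowerSeries.X))
      ^ (n + 1) with hfdef
  have hf0 : ∀ n, PowerSeries.constantCoeff (f n) = 1 := fun n => by simp [f]
  refine limitClass_of_tendsto (f := f) (l := atTop)
    (fun n => limitClass_pow (limitClass_mul (one_sub_mem_limitClass _)
      (one_sub_mem_limitClass _)) _) ?_
  refine tendsto_of_tendsto_powerSums hf0 (constantCoeff_gaussSeries α) ?_
  rw [PowerSeries.WithPiTopology.tendsto_iff_coeff_tendsto]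
  intro k
  have h1 : ∀ n, PowerSeries.coeff k (powerSums (f n))
      = (n + 1) * (if k = 0 then 0 else x n ^ k + (-x n) ^ k) := fun n => by
    simp only [hfdef]
    rw [powerSums_pow (by simp), powerSums_mul (constantCoeff_one_sub _) (constantCoeff_one_sub _),
      powerSums_one_sub, powerSums_one_sub, map_nsmul, map_add, PowerSeries.coeff_mk,
      PowerSeries.coeff_mk]
    split_ifs <;> simp [mul_add]
  simp only [h1, powerSums_gaussSeries, PowerSeries.coeff_C_mul, PowerSeries.coeff_X_pow]
  rcases k with _ | _ | _ | k
  · simp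
  · simp
  · have : ∀ n : ℕ, ((n : ℝ) + 1) * (x n ^ 2 + (-x n) ^ 2) = 2 * α := fun n => by
      linear_combination 2 * hx2 n
    simp only [this, if_neg (show ¬ (0 + 1 + 1 = 0) by omega), zero_add, Nat.reduceAdd, if_true,
      mul_one]
    exact tendsto_const_nhds
  · rw [if_neg (by omega), mul_zero]
    have h3 := ((hx0.pow (k + 1)).add (hx0.neg.pow (k + 1))).const_mul α
    simp only [neg_zero, zero_pow k.succ_ne_zero, add_zero, mul_zero] at h3
    refine h3.congr fun n => ?_
    rw [if_neg (by omega), ← hx2 n]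
    ring

theorem primarySeries_mem_limitClass (b : ℝ) : primarySeries b ∈ limitClass 0 :=
  limitClass_mul (one_sub_mem_limitClass b) (expSeries_mem_limitClass b)

theorem exists_represents_lp (α β : ℝ) {ι : Type*} {b : ι → ℝ} (hb : Summable fun j => b j ^ 2) :
    ∃ f : PowerSeries ℝ,
      Represents f (fun z => Complex.exp (-α * z ^ 2 + β * z) * ∏' j, primaryFactor (b j) z) ∧
      PowerSeries.constantCoeff f = 1 ∧ (0 ≤ α → f ∈ limitClass 0) ∧
      powerSums f = PowerSeries.mk fun k =>
        if k = 0 then 0 else if k = 1 then -β else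
          if k = 2 then 2 * α + ∑' j, b j ^ 2 else ∑' j, b j ^ k := by
  obtain ⟨f, hf, hf1, hlim, hsum⟩ := exists_represents_tprod_primaryFactor hb
  have hc : PowerSeries.constantCoeff (gaussSeries α * expSeries β) = 1 := by
    rw [map_mul, constantCoeff_gaussSeries, constantCoeff_expSeries, one_mul]
  refine ⟨gaussSeries α * expSeries β * f, ?_, ?_, ?_, ?_⟩
  · have := ((represents_gaussSeries α).mul (represents_expSeries β)).mul hf
    simpa only [← Complex.exp_add] using this
  · rw [map_mul, hc, hf1, one_mul]
  · intro hα
    exact limitClass_mul (limitClass_mul (gaussSeries_mem_limitClass hα)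
      (expSeries_mem_limitClass β)) (limitClass_of_tendsto
        (fun s => limitClass_prod s fun j => primarySeries_mem_limitClass (b j)) hlim)
  · rw [powerSums_mul hc hf1,
      powerSums_mul (constantCoeff_gaussSeries α) (constantCoeff_expSeries β),
      powerSums_gaussSeries, powerSums_expSeries]
    ext k
    rw [map_add, map_add, ← (hsum k).tsum_eq, PowerSeries.coeff_mk, PowerSeries.coeff_C_mul,
      PowerSeries.coeff_C_mul, PowerSeries.coeff_X_pow, PowerSeries.coeff_X]
    rcases k with _ | _ | _ | k <;> simp

end LaguerrePolya

/-! ### Compactness for power sums of reciprocal zeros -/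

namespace LaguerrePolya

open Filter Topology
open scoped PowerSeries.WithPiTopology

/-- Families of varying size become sequences in one space by zero padding, which changes no power
sum with `k ≠ 0`. Sorting by absolute value gives the uniform decay used below. -/
theorem exists_antitone_enumeration {d : ℕ} (x : Fin d → ℝ) :
    ∃ y : ℕ → ℝ, Antitone (fun j => |y j|) ∧
      ∀ k, k ≠ 0 → HasSum (fun j => y j ^ k) (∑ i, x i ^ k) := by
  set σ := Tuple.sort fun i => -|x i| with hσ
  have hmono : Monotone ((fun i => -|x i|) ∘ σ) := Tuple.monotone_sort _
  refine ⟨fun j => if h : j < d then x (σ ⟨j, h⟩) else 0, fun i j hij => ?_, fun k hk => ?_⟩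
  · by_cases hj : j < d
    · have hi : i < d := hij.trans_lt hj
      have := hmono (show (⟨i, hi⟩ : Fin d) ≤ ⟨j, hj⟩ from hij)
      simp only [Function.comp_apply, neg_le_neg_iff] at this
      simpa [hi, hj] using this
    · simp [hj]
  · have h1 : ∑ i, x i ^ k = ∑ j ∈ Finset.range d,
        (if h : j < d then x (σ ⟨j, h⟩) else 0) ^ k := by
      rw [← Equiv.sum_comp σ, Finset.sum_range]
      simp
    rw [h1]
    refine hasSum_sum_of_ne_finset_zero fun j hj => ?_
    have hj' : ¬ j < d := by simpa using hj
    simp [hj', hk]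

theorem sq_le_div_of_antitone {y : ℕ → ℝ} (hy : Antitone fun j => |y j|) {s : ℝ}
    (hs : HasSum (fun j => y j ^ 2) s) (j : ℕ) : y j ^ 2 ≤ s / ((j : ℝ) + 1) := by
  rw [le_div_iff₀ (by positivity)]
  have h1 : ∑ i ∈ Finset.range (j + 1), y j ^ 2 ≤ ∑ i ∈ Finset.range (j + 1), y i ^ 2 := by
    refine Finset.sum_le_sum fun i hi => ?_
    rw [sq_le_sq]
    exact hy (Nat.lt_succ_iff.1 (Finset.mem_range.1 hi))
  have h2 := sum_le_hasSum (Finset.range (j + 1)) (fun i _ => sq_nonneg (y i)) hs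
  simp only [Finset.sum_const, Finset.card_range, nsmul_eq_mul] at h1
  push_cast at h1
  linarith

/-- The dominating series for the sorted families. For `k = 2` it would be harmonic, which is why
mass can be lost there. -/
theorem summable_sqrt_div_pow (C : ℝ) {k : ℕ} (hk : 3 ≤ k) :
    Summable fun j : ℕ => √(C / ((j : ℝ) + 1)) ^ k := by
  have h1 : Summable fun j : ℕ => (((j : ℝ) + 1) ^ (3 / 2 : ℝ))⁻¹ := by
    have := (summable_nat_add_iff 1).2
      (Real.summable_nat_rpow_inv.2 (show (1 : ℝ) < 3 / 2 by norm_num))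
    simpa using this
  refine (h1.mul_left (√C ^ k)).of_nonneg_of_le (fun j => by positivity) fun j => ?_
  have hj : (0 : ℝ) ≤ (j : ℝ) + 1 := by positivity
  rw [Real.sqrt_div' _ hj, div_pow, div_eq_mul_inv]
  refine mul_le_mul_of_nonneg_left ?_ (by positivity)
  have h2 : ((j : ℝ) + 1) ^ (3 / 2 : ℝ) = √((j : ℝ) + 1) ^ 3 := by
    rw [Real.sqrt_eq_rpow, ← Real.rpow_natCast, ← Real.rpow_mul hj]
    norm_num
  rw [h2]
  refine inv_anti₀ (by positivity) (pow_le_pow_right₀ ?_ hk)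
  rw [Real.one_le_sqrt]
  linarith [(Nat.cast_nonneg j : (0 : ℝ) ≤ j)]

/-- If all power sums of finite real families converge, then the limits are the power sums of
a real sequence, up to a nonnegative defect in the second one. -/
theorem exists_limit_power_sums {d : ℕ → ℕ} (x : ∀ n, Fin (d n) → ℝ) {S : ℕ → ℝ}
    (h : ∀ k, k ≠ 0 → Tendsto (fun n => ∑ i, x n i ^ k) atTop (𝓝 (S k))) :
    ∃ (α : ℝ) (b : ℕ → ℝ), 0 ≤ α ∧ Summable (fun j => b j ^ 2) ∧
      S 2 = 2 * α + ∑' j, b j ^ 2 ∧ ∀ k, 3 ≤ k → S k = ∑' j, b j ^ k := by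
  choose y hy hsum using fun n => exists_antitone_enumeration (x n)
  obtain ⟨C, hC⟩ := (h 2 two_ne_zero).bddAbove_range
  have hC' : ∀ n, ∑ i, x n i ^ 2 ≤ C := fun n => hC ⟨n, rfl⟩
  have hyle : ∀ n j, |y n j| ≤ √(C / ((j : ℝ) + 1)) := fun n j => by
    refine Real.abs_le_sqrt ((sq_le_div_of_antitone (hy n) (hsum n 2 two_ne_zero) j).trans ?_)
    exact div_le_div_of_nonneg_right (hC' n) (by positivity)
  have hcpt : IsCompact (Set.pi Set.univ fun j : ℕ =>
      Set.Icc (-√(C / ((j : ℝ) + 1))) (√(C / ((j : ℝ) + 1)))) :=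
    isCompact_univ_pi fun _ => isCompact_Icc
  obtain ⟨b, -, φ, hφ, hb⟩ := hcpt.tendsto_subseq (x := y) fun n j _ => abs_le.1 (hyle n j)
  rw [tendsto_pi_nhds] at hb
  have hS : ∀ k, k ≠ 0 → Tendsto (fun n => ∑ i, x (φ n) i ^ k) atTop (𝓝 (S k)) := fun k hk =>
    (h k hk).comp hφ.tendsto_atTop
  -- Fatou's inequality on finite partial sums: the limit sequence is square summable and the defect
  -- `2α` is nonnegative.
  have hle : ∀ s : Finset ℕ, ∑ j ∈ s, b j ^ 2 ≤ S 2 := fun s => by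
    refine le_of_tendsto_of_tendsto' (tendsto_finsetSum s fun j _ => (hb j).pow 2)
      (hS 2 two_ne_zero) fun n => ?_
    exact sum_le_hasSum s (fun i _ => sq_nonneg _) (hsum (φ n) 2 two_ne_zero)
  have hbs : Summable fun j => b j ^ 2 := summable_of_sum_le (fun j => sq_nonneg _) hle
  refine ⟨(S 2 - ∑' j, b j ^ 2) / 2, b, ?_, hbs, by ring, fun k hk => ?_⟩
  · linarith [hbs.tsum_le_of_sum_le hle]
  · have hk0 : k ≠ 0 := by omega
    have := tendsto_tsum_of_dominated_convergence (𝓕 := atTop)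
      (f := fun n j => y (φ n) j ^ k) (g := fun j => b j ^ k)
      (summable_sqrt_div_pow C hk) (fun j => (hb j).pow k)
      (Eventually.of_forall fun n j => by
        rw [norm_pow, Real.norm_eq_abs]
        exact pow_le_pow_left₀ (abs_nonneg _) (hyle _ j) k)
    simp only [(hsum _ k hk0).tsum_eq] at this
    exact tendsto_nhds_unique (hS k hk0) this

section Splits

variable {K : Type*} [Field K]

open Polynomial in
theorem exists_prod_one_sub {p : K[X]} (hp : p.Splits) (h0 : p.coeff 0 = 1) :
    ∃ x : Fin p.natDegree → K,
      (p : PowerSeries K) = ∏ i, (1 - PowerSeries.C (x i) * PowerSeries.X) := by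
  have hp0 : p ≠ 0 := by rintro rfl; simp at h0
  have hroot : ∀ a ∈ p.roots, a ≠ 0 := by
    rintro a ha rfl
    have := (mem_roots'.1 ha).2
    rw [IsRoot, ← coeff_zero_eq_eval_zero, h0] at this
    exact one_ne_zero this
  -- For a nonzero root, `X - a = -a (1 - a⁻¹ X)`; the accumulated constant is later cancelled by
  -- the leading coefficient, since the constant term is `1`.
  have key : ∀ l : List K, (∀ a ∈ l, a ≠ 0) → ∃ c : K,
      (l.map fun a => X - C a).prod = C c * (l.map fun a => 1 - C a⁻¹ * X).prod := by
    intro l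
    induction l with
    | nil => exact fun _ => ⟨1, by simp⟩
    | cons a l ih =>
      intro hl
      obtain ⟨c, hc⟩ := ih fun b hb => hl b (List.mem_cons_of_mem a hb)
      refine ⟨-a * c, ?_⟩
      have ha : C a * C a⁻¹ = (1 : K[X]) := by
        rw [← C_mul, mul_inv_cancel₀ (hl a List.mem_cons_self), C_1]
      rw [List.map_cons, List.prod_cons, List.map_cons, List.prod_cons, hc, C_mul, C_neg]
      linear_combination (-(X * C c * (l.map fun a => 1 - C a⁻¹ * X).prod)) * ha
  obtain ⟨l, hl⟩ := Quot.exists_rep p.roots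
  have hl : (l : Multiset K) = p.roots := hl
  obtain ⟨c, hc⟩ := key l fun a ha => hroot a (by rw [← hl]; exact ha)
  have h1 := hp.eq_prod_roots
  rw [← hl, Multiset.map_coe, Multiset.prod_coe, hc, ← mul_assoc, ← C_mul] at h1
  have h2 : p.leadingCoeff * c = 1 := by
    have h3 := congrArg (evalRingHom (0 : K)) h1
    rw [map_mul, map_list_prod, List.map_map,
      List.map_congr_left (g := fun _ => (1 : K)) (fun a _ => by simp), coe_evalRingHom,
      ← coeff_zero_eq_eval_zero, h0, eval_C] at h3
    simpa using h3.symm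
  rw [h2, C_1, one_mul] at h1
  have h4 : l.length = p.natDegree := by
    rw [hp.natDegree_eq_card_roots, ← hl, Multiset.coe_card]
  rw [← h4]
  refine ⟨fun i => (l[i])⁻¹, ?_⟩
  refine Eq.trans ?_ (Fin.prod_univ_fun_getElem l
    fun a => (1 - PowerSeries.C a⁻¹ * PowerSeries.X : PowerSeries K)).symm
  have h5 := congrArg (coeToPowerSeries.ringHom (R := K)) h1
  rw [map_list_prod, List.map_map] at h5
  rw [← coeToPowerSeries.ringHom_apply, h5]
  congr 1
  refine List.map_congr_left fun a _ => ?_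
  simp

/-- Padding with zeros gives all polynomials of degree at most `M` the same index type, as
compactness requires. -/
theorem exists_prod_one_sub_of_le {p : Polynomial K} (hp : p.Splits) (h0 : p.coeff 0 = 1) {M : ℕ}
    (hM : p.natDegree ≤ M) :
    ∃ x : Fin M → K,
      (p : PowerSeries K) = ∏ i, (1 - PowerSeries.C (x i) * PowerSeries.X) := by
  obtain ⟨e, rfl⟩ := Nat.exists_eq_add_of_le hM
  obtain ⟨x, hx⟩ := exists_prod_one_sub hp h0
  refine ⟨Fin.append x 0, ?_⟩
  rw [Fin.prod_univ_add, hx]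
  simp

theorem coeff_powerSums_prod_one_sub {ι : Type*} [Fintype ι] (x : ι → K) {k : ℕ} (hk : k ≠ 0) :
    PowerSeries.coeff k (powerSums (∏ i, (1 - PowerSeries.C (x i) * PowerSeries.X)))
      = ∑ i, x i ^ k := by
  rw [powerSums_prod _ fun i => constantCoeff_one_sub (x i), map_sum]
  simp [powerSums_one_sub, hk]

end Splits

/-- Recurrence in a compact group: powers of a point of the torus return to every neighbourhood of
`1`. Working with `v ^ 2` makes the exponent even. -/
theorem exists_pow_re_gt {M : ℕ} (v : Fin M → Circle) :
    ∃ k, k ≠ 0 ∧ Even k ∧ ∀ i, 1 / 2 < ((v i ^ k : Circle) : ℂ).re := by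
  have hW : IsOpen {w : Fin M → Circle | ∀ i, 1 / 2 < (w i : ℂ).re} := by
    simp only [Set.ofPred_forall]
    refine isOpen_iInter_of_finite fun i => ?_
    exact isOpen_lt continuous_const (Complex.continuous_re.comp
      (continuous_subtype_val.comp (continuous_apply i)))
  have h := (mapClusterPt_one_atTop_pow (v ^ 2)).frequently
    (hW.mem_nhds (by simp only [Set.mem_ofPred_eq, Pi.one_apply, Circle.coe_one]; norm_num))
  obtain ⟨j, hj, hj1⟩ := (h.and_eventually (eventually_ge_atTop 1)).exists
  refine ⟨2 * j, by omega, even_two_mul j, fun i => ?_⟩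
  have := hj i
  simpa only [pow_mul, Pi.pow_apply] using this

/-- If the power sums of `x n` (real families) together with `u n` (complex families of bounded
size) are bounded, then a subsequence of `u n` converges. -/
theorem exists_tendsto_subseq_of_power_sums {d : ℕ → ℕ} (x : ∀ n, Fin (d n) → ℝ) {M : ℕ}
    (u : ℕ → Fin M → ℂ) {T : ℕ → ℕ → ℝ}
    (hT : ∀ k, k ≠ 0 → ∀ n, ∑ i, x n i ^ k + (∑ i, u n i ^ k).re = T k n)
    (hb : ∀ k, k ≠ 0 → BddAbove (Set.range (T k))) :
    ∃ (v : Fin M → ℂ) (φ : ℕ → ℕ), StrictMono φ ∧ Tendsto (u ∘ φ) atTop (𝓝 v) := by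
  -- The directions of the `u n i`; when `u n i = 0` the direction is `1` and the polar form still
  -- holds.
  set w : ℕ → Fin M → Circle := fun n i => Circle.exp (u n i).arg
  have hw : ∀ n i, u n i = ‖u n i‖ * (w n i : ℂ) := fun n i => by
    rw [Circle.coe_exp]
    exact (Complex.norm_mul_exp_arg_mul_I _).symm
  obtain ⟨v, φ, hφ, hv⟩ := CompactSpace.tendsto_subseq w
  -- For this `k`, eventually along `φ`, each `u ^ k` has real part at least `‖u‖ ^ k / 2`, while
  -- the real terms `x ^ k` are nonnegative as `k` is even. Nothing can cancel, so one bounded power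
  -- sum bounds every `u`.
  obtain ⟨k, hk0, hk, hvk⟩ := exists_pow_re_gt v
  have hev : ∀ᶠ n in atTop, ∀ i, 1 / 2 < ((w (φ n) i ^ k : Circle) : ℂ).re := by
    rw [eventually_all]
    intro i
    have hi := ((tendsto_pi_nhds.1 hv i).pow k)
    have h2 : Continuous fun z : Circle => (z : ℂ).re :=
      Complex.continuous_re.comp continuous_subtype_val
    exact ((h2.tendsto _).comp hi).eventually (lt_mem_nhds (hvk i))
  obtain ⟨C, hC⟩ := hb k hk0
  have hbd : ∀ᶠ n in atTop, u (φ n) ∈ Metric.closedBall (0 : Fin M → ℂ) (max 1 (2 * C)) := by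
    filter_upwards [hev] with n hn
    rw [mem_closedBall_zero_iff, pi_norm_le_iff_of_nonneg (by positivity)]
    intro i
    have h1 : ∀ j, ‖u (φ n) j‖ ^ k / 2 ≤ (u (φ n) j ^ k).re := fun j => by
      have h3 : (u (φ n) j ^ k).re = ‖u (φ n) j‖ ^ k * ((w (φ n) j ^ k : Circle) : ℂ).re := by
        rw [hw (φ n) j, mul_pow, ← Complex.ofReal_pow, Complex.re_ofReal_mul, Circle.coe_pow,
          ← hw (φ n) j]
      rw [h3]
      have := mul_le_mul_of_nonneg_left (hn j).le (pow_nonneg (norm_nonneg (u (φ n) j)) k)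
      linarith
    have h2 : ‖u (φ n) i‖ ^ k / 2 ≤ C := by
      calc ‖u (φ n) i‖ ^ k / 2 ≤ ∑ j, ‖u (φ n) j‖ ^ k / 2 :=
            Finset.single_le_sum (f := fun j => ‖u (φ n) j‖ ^ k / 2) (fun j _ => by positivity)
              (Finset.mem_univ i)
        _ ≤ ∑ j, (u (φ n) j ^ k).re := Finset.sum_le_sum fun j _ => h1 j
        _ = (∑ j, u (φ n) j ^ k).re := by rw [Complex.re_sum]
        _ ≤ ∑ j, x (φ n) j ^ k + (∑ j, u (φ n) j ^ k).re := by
            linarith [Finset.sum_nonneg fun j (_ : j ∈ Finset.univ) => hk.pow_nonneg (x (φ n) j)]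
        _ = T k (φ n) := hT k hk0 _
        _ ≤ C := hC ⟨_, rfl⟩
    rcases le_total ‖u (φ n) i‖ 1 with h | h
    · exact h.trans (le_max_left _ _)
    · refine le_trans ?_ (le_max_right _ _)
      linarith [le_self_pow₀ h hk0]
  obtain ⟨a, -, ψ, hψ, ha⟩ :=
    tendsto_subseq_of_frequently_bounded Metric.isBounded_closedBall hbd.frequently
  exact ⟨a, φ ∘ ψ, hφ.comp hψ, ha⟩

end LaguerrePolya

/-! ### The Laguerre–Pólya theorem -/

namespace LaguerrePolya

open Filter Topology
open scoped PowerSeries.WithPiTopology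

theorem isLP_of_tprod_primaryFactor {α β : ℝ} (hα : 0 ≤ α) {b : ℕ → ℝ}
    (hb : Summable fun j => b j ^ 2) :
    IsLP fun z => Complex.exp (-α * z ^ 2 + β * z) * ∏' j, primaryFactor (b j) z := by
  -- Here `b j` is the reciprocal of a zero; indices with `b j = 0` contribute the factor `1` and
  -- are dropped.
  refine ⟨1, 0, α, β, {j | b j ≠ 0}, fun j => (b j)⁻¹, fun z => ∏' j, primaryFactor (b j) z, hα,
    fun j => inv_ne_zero j.2, ?_, fun z => ?_, fun z => by simp⟩
  · refine (hb.subtype _).congr fun j => ?_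
    simp [abs_inv]
  · have h : Function.mulSupport (fun j => primaryFactor (b j) z) ⊆ {j | b j ≠ 0} := by
      intro j hj hj0
      exact hj (by simp [primaryFactor, hj0])
    have := (hasProd_subtype_iff_of_mulSupport_subset h).2 (hasProd_primaryFactor hb z)
    convert! this using 2 with j
    simp [primaryFactor, mul_comm, div_eq_mul_inv]

theorem exists_splits_mul_of_coeff_zero {p : Polynomial ℝ} (h0 : p.coeff 0 = 1) :
    ∃ s q : Polynomial ℝ, p = s * q ∧ s.Splits ∧ s.coeff 0 = 1 ∧ q.coeff 0 = 1 ∧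
      q.natDegree = nonrealDegree p := by
  obtain ⟨s, q, h, hs, hq, -⟩ := exists_splits_mul p
  have h1 : s.coeff 0 * q.coeff 0 = 1 := by rw [← Polynomial.mul_coeff_zero, ← h, h0]
  have h2 : s.coeff 0 ≠ 0 := left_ne_zero_of_mul_eq_one h1
  refine ⟨Polynomial.C (s.coeff 0)⁻¹ * s, Polynomial.C (s.coeff 0) * q, ?_, hs.C_mul _, ?_, ?_, ?_⟩
  · rw [mul_mul_mul_comm, ← Polynomial.C_mul, inv_mul_cancel₀ h2, Polynomial.C_1, one_mul, h]
  · simp [h2]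
  · simp [h1]
  · rw [Polynomial.natDegree_C_mul h2, hq]

theorem map_coe_polynomial (p : Polynomial ℝ) :
    PowerSeries.map (algebraMap ℝ ℂ) (p : PowerSeries ℝ)
      = ((p.map (algebraMap ℝ ℂ) : Polynomial ℂ) : PowerSeries ℂ) := by
  ext k
  simp

/-- A coefficientwise limit of real polynomials of degree at most `M` is, when it exists over the
complex numbers, a real polynomial of degree at most `M`. -/
theorem exists_polynomial_of_tendsto {M : ℕ} {q : ℕ → Polynomial ℝ}
    (hq : ∀ n, (q n).natDegree ≤ M) {g : PowerSeries ℂ}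
    (h : Tendsto (fun n => PowerSeries.map (algebraMap ℝ ℂ) (q n : PowerSeries ℝ)) atTop (𝓝 g)) :
    ∃ Q : Polynomial ℝ, Q.natDegree ≤ M ∧
      PowerSeries.map (algebraMap ℝ ℂ) (Q : PowerSeries ℝ) = g := by
  rw [PowerSeries.WithPiTopology.tendsto_iff_coeff_tendsto] at h
  simp only [PowerSeries.coeff_map, Polynomial.coeff_coe] at h
  have him : ∀ k, (((PowerSeries.coeff k g).re : ℝ) : ℂ) = PowerSeries.coeff k g := fun k => by
    have h2 := (Complex.continuous_im.tendsto _).comp (h k)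
    have h3 : (PowerSeries.coeff k g).im = 0 :=
      tendsto_nhds_unique h2 (by simp [Function.comp_def])
    apply Complex.ext <;> simp [h3]
  have hzero : ∀ k, M < k → PowerSeries.coeff k g = 0 := fun k hk => by
    refine tendsto_nhds_unique (h k) ?_
    simp [fun n => Polynomial.coeff_eq_zero_of_natDegree_lt ((hq n).trans_lt hk)]
  set Q : Polynomial ℝ := PowerSeries.trunc (M + 1)
    (PowerSeries.mk fun k => (PowerSeries.coeff k g).re) with hQ
  refine ⟨Q, Nat.lt_succ_iff.1 (PowerSeries.natDegree_trunc_lt _ _), ?_⟩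
  ext k
  rw [PowerSeries.coeff_map, Polynomial.coeff_coe, hQ, PowerSeries.coeff_trunc,
    PowerSeries.coeff_mk]
  split_ifs with hk
  · exact him k
  · rw [hzero k (by omega), map_zero]

instance : FirstCountableTopology (PowerSeries ℝ) :=
  inferInstanceAs (FirstCountableTopology ((Unit →₀ ℕ) → ℝ))

/-- The Laguerre-Pólya theorem for limits of polynomials with boundedly many non-real zeros. -/
theorem exists_eq_mul_of_mem_limitClass {M : ℕ} {h : PowerSeries ℝ} (hh : h ∈ limitClass M) :
    ∃ (Q : Polynomial ℝ) (g : PowerSeries ℝ) (G : ℂ → ℂ), Q.natDegree ≤ M ∧ h = Q * g ∧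
      Represents g G ∧ IsLP G ∧ ∀ z ∈ nonreal, G z ≠ 0 := by
  have hh1 := constantCoeff_of_mem_limitClass hh
  obtain ⟨f, hf, hlim⟩ := mem_closure_iff_seq_limit.1 hh
  choose p hfp hp0 hpM using hf
  obtain rfl : f = fun n => (p n : PowerSeries ℝ) := funext hfp
  choose s q hsq hs hs0 hq0 hqd using fun n => exists_splits_mul_of_coeff_zero (hp0 n)
  choose x hx using fun n => exists_prod_one_sub (hs n) (hs0 n)
  have hqdM : ∀ n, (q n).natDegree ≤ M := fun n => (hqd n).le.trans (hpM n)
  choose u hu using fun n => exists_prod_one_sub_of_le (M := M)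
    (IsAlgClosed.splits ((q n).map (algebraMap ℝ ℂ))) (by simp [hq0 n])
    (by simpa using hqdM n)
  have hcp : ∀ n, PowerSeries.constantCoeff (p n : PowerSeries ℝ) = 1 := fun n => by
    simpa using! hp0 n
  have hcs : ∀ n, PowerSeries.constantCoeff (s n : PowerSeries ℝ) = 1 := fun n => by
    simpa using! hs0 n
  have hcq : ∀ n, PowerSeries.constantCoeff (q n : PowerSeries ℝ) = 1 := fun n => by
    simpa using! hq0 n
  set T : ℕ → ℕ → ℝ := fun k n => PowerSeries.coeff k (powerSums (p n : PowerSeries ℝ)) with hTdef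
  have hTlim : ∀ k, Tendsto (T k) atTop (𝓝 (PowerSeries.coeff k (powerSums h))) :=
    (PowerSeries.WithPiTopology.tendsto_iff_coeff_tendsto ..).1 (tendsto_powerSums hcp hh1 hlim)
  have hqu : ∀ k, k ≠ 0 → ∀ n, ((PowerSeries.coeff k (powerSums (q n : PowerSeries ℝ)) : ℝ) : ℂ)
      = ∑ i, u n i ^ k := fun k hk n => by
    rw [← coeff_powerSums_prod_one_sub _ hk, ← hu n, ← map_coe_polynomial,
      powerSums_map _ (hcq n), PowerSeries.coeff_map]
    rfl
  have hT : ∀ k, k ≠ 0 → ∀ n, ∑ i, x n i ^ k + (∑ i, u n i ^ k).re = T k n := fun k hk n => by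
    rw [← hqu k hk n, Complex.ofReal_re, ← coeff_powerSums_prod_one_sub _ hk, ← hx n, hTdef]
    simp only
    rw [hsq n, Polynomial.coe_mul, powerSums_mul (hcs n) (hcq n), map_add]
  -- Along `φ` the factors with the non-real zeros converge to a polynomial `Q` of degree at most
  -- `M`. Subtracting its power sums leaves limits for the real families.
  obtain ⟨v, φ, hφ, hv⟩ := exists_tendsto_subseq_of_power_sums x u hT
    fun k _ => (hTlim k).bddAbove_range
  have hv' := tendsto_pi_nhds.1 hv
  have hqlim : Tendsto (fun n => PowerSeries.map (algebraMap ℝ ℂ) (q (φ n) : PowerSeries ℝ)) atTop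
      (𝓝 (∏ i, (1 - PowerSeries.C (v i) * PowerSeries.X))) := by
    simp only [map_coe_polynomial, hu]
    refine tendsto_finsetProd _ fun i _ => tendsto_const_nhds.sub (Tendsto.mul ?_ tendsto_const_nhds)
    exact (PowerSeries.WithPiTopology.continuous_C.tendsto _).comp (hv' i)
  obtain ⟨Q, hQM, hQ⟩ := exists_polynomial_of_tendsto (fun n => hqdM (φ n)) hqlim
  have hcQ : PowerSeries.constantCoeff (Q : PowerSeries ℝ) = 1 := by
    have := congrArg PowerSeries.constantCoeff hQ
    rw [constantCoeff_prod _ fun i _ => constantCoeff_one_sub (v i),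
      ← PowerSeries.coeff_zero_eq_constantCoeff_apply, PowerSeries.coeff_map,
      PowerSeries.coeff_zero_eq_constantCoeff_apply] at this
    exact (algebraMap ℝ ℂ).injective (this.trans (map_one _).symm)
  have hQv : ∀ k, k ≠ 0 → ((PowerSeries.coeff k (powerSums (Q : PowerSeries ℝ)) : ℝ) : ℂ)
      = ∑ i, v i ^ k := fun k hk => by
    rw [← coeff_powerSums_prod_one_sub _ hk, ← hQ, powerSums_map _ hcQ, PowerSeries.coeff_map]
    rfl
  set S : ℕ → ℝ := fun k => PowerSeries.coeff k (powerSums h)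
    - PowerSeries.coeff k (powerSums (Q : PowerSeries ℝ)) with hS
  have hxS : ∀ k, k ≠ 0 → Tendsto (fun n => ∑ i, x (φ n) i ^ k) atTop (𝓝 (S k)) := fun k hk => by
    have h1 : ∀ n, ∑ i, x (φ n) i ^ k = T k (φ n) - (∑ i, u (φ n) i ^ k).re := fun n => by
      rw [← hT k hk]; ring
    have h2 : S k = PowerSeries.coeff k (powerSums h) - (∑ i, v i ^ k).re := by
      rw [← hQv k hk, Complex.ofReal_re]
    simp only [h1, h2]
    refine ((hTlim k).comp hφ.tendsto_atTop).sub ((Complex.continuous_re.tendsto _).comp ?_)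
    exact tendsto_finsetSum _ fun i _ => (hv' i).pow k
  obtain ⟨α, b, hα, hb, hS2, hS3⟩ := exists_limit_power_sums (fun n => x (φ n)) hxS
  -- The primary factors have no first power sum, so `S 1` is matched by the exponential alone, with
  -- `β = -S 1`.
  obtain ⟨g, hg, hcg, -, hgp⟩ := exists_represents_lp α (-S 1) hb
  refine ⟨Q, g, _, hQM, ?_, hg, isLP_of_tprod_primaryFactor hα hb, fun z hz =>
    mul_ne_zero (Complex.exp_ne_zero _) (tprod_primaryFactor_ne_zero hb hz)⟩
  refine powerSums_injective hh1 (by rw [map_mul, hcQ, hcg, one_mul]) ?_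
  ext k
  rw [powerSums_mul hcQ hcg, map_add, hgp, PowerSeries.coeff_mk]
  rcases k with _ | _ | _ | k
  · simp [coeff_zero_powerSums]
  · simp [hS]
  · have := hS2
    simp only [hS] at this
    rw [if_neg (by omega), if_neg (by omega), if_pos (by omega), ← this]
    ring
  · have := hS3 (k + 3) (by omega)
    simp only [hS] at this
    rw [if_neg (by omega), if_neg (by omega), if_neg (by omega), ← this]
    ring

end LaguerrePolya

/-! ### Appell polynomials and the limit class -/

namespace LaguerrePolya

open Filter Topology Polynomial
open scoped PowerSeries.WithPiTopology

theorem nonrealDegree_reflect_le {n : ℕ} {p : ℝ[X]} (hp : p.natDegree ≤ n) :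
    nonrealDegree (reflect n p) ≤ nonrealDegree p := by
  obtain ⟨e, rfl⟩ := Nat.exists_eq_add_of_le hp
  have h := reflect_mul p (C 1) le_rfl (show (C (1 : ℝ)).natDegree ≤ e by simp)
  rw [reflect_C, C_1, mul_one, one_mul, mul_comm] at h
  rw [h, nonrealDegree_X_pow_mul]
  exact nonrealDegree_reverse_le p

theorem natDegree_C_mul_X_le_one (r : ℝ) : (C r * X).natDegree ≤ 1 :=
  (natDegree_C_mul_le _ _).trans natDegree_X_le

theorem natDegree_reflect_le_of_le {n : ℕ} {p : ℝ[X]} (hp : p.natDegree ≤ n) :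
    (reflect n p).natDegree ≤ n := by
  rw [natDegree_le_iff_coeff_eq_zero]
  intro j hj
  rw [coeff_reflect, revAt_eq_self_of_lt hj]
  exact coeff_eq_zero_of_natDegree_lt (hp.trans_lt hj)

theorem nonrealDegree_reflect {n : ℕ} {p : ℝ[X]} (hp : p.natDegree ≤ n) :
    nonrealDegree (reflect n p) = nonrealDegree p := by
  refine (nonrealDegree_reflect_le hp).antisymm ?_
  have h := nonrealDegree_reflect_le (natDegree_reflect_le_of_le hp)
  rwa [reflect_reflect] at h

theorem coeff_reflect_appell (f : PowerSeries ℝ) (n k : ℕ) :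
    (reflect n (appell f n)).coeff k =
      if k ≤ n then (n.factorial : ℝ) / (n - k).factorial * PowerSeries.coeff k f else 0 := by
  rw [coeff_reflect]
  split_ifs with hk
  · rw [revAt_le hk, coeff_appell, if_pos (Nat.sub_le _ _), Nat.sub_sub_self hk]
  · rw [revAt_eq_self_of_lt (by omega), coeff_appell, if_neg hk]

theorem tendsto_factorial_div (k : ℕ) :
    Tendsto (fun n : ℕ => (n.factorial : ℝ) / ((n - k).factorial * (n : ℝ) ^ k)) atTop (𝓝 1) := by
  induction k with
  | zero =>
    refine tendsto_const_nhds.congr fun n => ?_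
    have : (n.factorial : ℝ) ≠ 0 := by positivity
    simp [this]
  | succ k ih =>
    have h1 : Tendsto (fun n : ℕ => 1 - (k : ℝ) / n) atTop (𝓝 1) := by
      simpa using (tendsto_const_div_atTop_nhds_zero_nat (k : ℝ)).const_sub 1
    have h2 := ih.mul h1
    rw [mul_one] at h2
    refine h2.congr' ?_
    filter_upwards [eventually_ge_atTop (k + 1)] with n hn
    obtain ⟨e, rfl⟩ := Nat.exists_eq_add_of_le hn
    rw [show k + 1 + e - k = e + 1 by omega, show k + 1 + e - (k + 1) = e by omega,
      Nat.factorial_succ e]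
    have h3 : ((e.factorial : ℕ) : ℝ) ≠ 0 := by positivity
    have h4 : ((k + 1 + e : ℕ) : ℝ) ≠ 0 := by positivity
    have h5 : ((e : ℝ) + 1) ≠ 0 := by positivity
    have h6 : ((k + 1 + e : ℕ) : ℝ) - k = e + 1 := by push_cast; ring
    rw [one_sub_div h4, h6, pow_succ]
    push_cast at h4 ⊢
    field_simp

/-- The reversed Appell polynomial at `z/n` has `k`-th coefficient `n!/((n-k)! n^k)` times that of
`h`, and this factor tends to `1`. At `n = 0` the scale `0⁻¹ = 0` is harmless: the constant
coefficient is still `1`. -/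
theorem mem_limitClass_of_nonrealDegree_appell_le {h : PowerSeries ℝ}
    (hh : PowerSeries.constantCoeff h = 1) {B : ℕ} (hB : ∀ n, nonrealDegree (appell h n) ≤ B) :
    h ∈ limitClass B := by
  set p : ℕ → ℝ[X] := fun n => (reflect n (appell h n)).comp (C ((n : ℝ)⁻¹) * X) with hp
  have hcoeff : ∀ n k, (p n).coeff k = (if k ≤ n then
      (n.factorial : ℝ) / (n - k).factorial * PowerSeries.coeff k h else 0) * ((n : ℝ)⁻¹) ^ k := by
    intro n k
    simp only [hp]
    rw [comp_C_mul_X_coeff, coeff_reflect_appell]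
  refine limitClass_of_tendsto (l := atTop) (f := fun n => (p n : PowerSeries ℝ))
    (fun n => coe_mem_limitClass ?_ ?_) ?_
  · rw [hcoeff, if_pos (Nat.zero_le _), PowerSeries.coeff_zero_eq_constantCoeff_apply, hh]
    have : (n.factorial : ℝ) ≠ 0 := by positivity
    simp [this]
  · refine (nonrealDegree_comp_le _ (natDegree_C_mul_X_le_one _)).trans ?_
    rw [nonrealDegree_reflect (natDegree_appell_le h n)]
    exact hB n
  · rw [PowerSeries.WithPiTopology.tendsto_iff_coeff_tendsto]
    intro k
    have h1 := (tendsto_factorial_div k).mul_const (PowerSeries.coeff k h)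
    rw [one_mul] at h1
    refine h1.congr' ?_
    filter_upwards [eventually_ge_atTop k] with n hn
    rw [coeff_coe, hcoeff, if_pos hn, inv_pow, div_mul_eq_div_div, div_eq_mul_inv _ ((n : ℝ) ^ k)]
    ring

theorem coeff_reflect_iterate_derivative_reflect (p : ℝ[X]) (n r k : ℕ) (hk : k ≤ n) :
    (reflect n (derivative^[r] (reflect (n + r) p))).coeff k
      = ((n + r - k).factorial : ℝ) / (n - k).factorial * p.coeff k := by
  rw [coeff_reflect, revAt_le hk, coeff_iterate_derivative, coeff_reflect, revAt_le (by omega),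
    show n + r - (n - k + r) = k by omega, nsmul_eq_mul, Nat.descFactorial_eq_div (by omega),
    Nat.add_sub_cancel, Nat.cast_div (Nat.factorial_dvd_factorial (by omega)) (by positivity),
    show n - k + r = n + r - k by omega]

/-- Reversing `p` in degree `w`, differentiating `w - n` times and reversing back multiplies the
`k`-th coefficient by `(w-k)!/(n-k)!`. After normalizing by `n!/w!` and substituting `wz` for `z`,
letting `w → ∞` leaves the Appell factor `n!/(n-k)!`. No step adds non-real zeros. -/
theorem reflect_appell_coe_mem_limitClass {p : ℝ[X]} {M : ℕ} (h0 : p.coeff 0 = 1)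
    (hM : nonrealDegree p ≤ M) (n : ℕ) :
    (reflect n (appell (p : PowerSeries ℝ) n) : PowerSeries ℝ) ∈ limitClass M := by
  -- Adding `p.natDegree` guarantees `deg p ≤ w r`, so that `reflect (w r)` is a genuine reversal.
  set w : ℕ → ℕ := fun r => n + (r + p.natDegree) with hw
  have hw_tendsto : Tendsto w atTop atTop :=
    tendsto_atTop_mono (fun r => by simp only [hw, id]; omega) tendsto_id
  set t : ℕ → ℝ[X] := fun r =>
    reflect n (derivative^[r + p.natDegree] (reflect (w r) p)) with ht
  set P : ℕ → ℝ[X] := fun r =>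
    C ((n.factorial : ℝ) / (w r).factorial) * (t r).comp (C ((w r : ℕ) : ℝ) * X) with hP
  have htdeg : ∀ r, (derivative^[r + p.natDegree] (reflect (w r) p)).natDegree ≤ n := fun r => by
    have h1 := natDegree_iterate_derivative (reflect (w r) p) (r + p.natDegree)
    have h2 := natDegree_reflect_le_of_le (n := w r) (p := p) (by simp only [hw]; omega)
    simp only [hw] at h1 h2 ⊢
    omega
  have hcoeff : ∀ r k, k ≤ n → (P r).coeff k = (n.factorial : ℝ) / (w r).factorial *
      (((w r - k).factorial : ℝ) / (n - k).factorial * p.coeff k * (w r : ℝ) ^ k) := by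
    intro r k hk
    simp only [hP, ht, hw]
    rw [coeff_C_mul, comp_C_mul_X_coeff, coeff_reflect_iterate_derivative_reflect _ _ _ _ hk]
  refine limitClass_of_tendsto (l := atTop) (f := fun r => (P r : PowerSeries ℝ))
    (fun r => coe_mem_limitClass ?_ ?_) ?_
  · rw [hcoeff r 0 (Nat.zero_le _), h0]
    have h1 : (n.factorial : ℝ) ≠ 0 := by positivity
    have h2 : ((w r).factorial : ℝ) ≠ 0 := by positivity
    simp only [Nat.sub_zero, pow_zero, mul_one]
    field_simp
  · refine (nonrealDegree_splits_mul_le (Splits.C _) _).trans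
      ((nonrealDegree_comp_le _ (natDegree_C_mul_X_le_one _)).trans ?_)
    refine (nonrealDegree_reflect_le (htdeg r)).trans
      ((nonrealDegree_iterate_derivative_le _ _).trans ?_)
    exact (nonrealDegree_reflect_le (by simp only [hw]; omega)).trans hM
  · rw [PowerSeries.WithPiTopology.tendsto_iff_coeff_tendsto]
    intro k
    simp only [coeff_coe, coeff_reflect_appell]
    split_ifs with hk
    · have h1 := (((tendsto_factorial_div k).comp hw_tendsto).inv₀ one_ne_zero).mul_const
        ((n.factorial : ℝ) / (n - k).factorial * p.coeff k)
      rw [inv_one, one_mul] at h1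
      refine h1.congr fun r => ?_
      rw [hcoeff r k hk, Function.comp_apply, inv_div]
      ring
    · refine tendsto_const_nhds.congr fun r => ?_
      rw [coeff_eq_zero_of_natDegree_lt]
      refine lt_of_le_of_lt ((natDegree_C_mul_le _ _).trans ?_) (not_le.1 hk)
      rw [natDegree_comp]
      exact (Nat.mul_le_mul (natDegree_reflect_le_of_le (htdeg r)) (natDegree_C_mul_X_le_one _)).trans
        (by simp)

theorem continuous_reflect_appell (n : ℕ) :
    Continuous fun f : PowerSeries ℝ => (reflect n (appell f n) : PowerSeries ℝ) := by
  rw [continuous_iff_continuousAt]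
  intro f
  rw [ContinuousAt, PowerSeries.WithPiTopology.tendsto_iff_coeff_tendsto]
  intro k
  simp only [coeff_coe, coeff_reflect_appell]
  split_ifs
  · exact ((PowerSeries.WithPiTopology.continuous_coeff ℝ k).tendsto f).const_mul _
  · exact tendsto_const_nhds

theorem reflect_appell_mem_limitClass {h : PowerSeries ℝ} {M : ℕ} (hh : h ∈ limitClass M)
    (n : ℕ) : (reflect n (appell h n) : PowerSeries ℝ) ∈ limitClass M := by
  refine closure_minimal ?_ (isClosed_closure.preimage (continuous_reflect_appell n)) hh
  rintro _ ⟨p, rfl, hp, hpM⟩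
  exact reflect_appell_coe_mem_limitClass hp hpM n

/-- Not immediate from the definition of the closure, since the approximants may have unbounded
degree. The factorization `p = Q g` shows that all non-real zeros of `p` are zeros of `Q`. -/
theorem nonrealDegree_le_of_coe_mem_limitClass {p : ℝ[X]} {M : ℕ}
    (h : (p : PowerSeries ℝ) ∈ limitClass M) : nonrealDegree p ≤ M := by
  obtain ⟨Q, g, G, hQ, hpg, hg, -, hG⟩ := exists_eq_mul_of_mem_limitClass h
  rcases eq_or_ne Q 0 with rfl | hQ0
  · have := constantCoeff_of_mem_limitClass h
    rw [hpg] at this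
    simp at this
  have h1 : (fun z : ℂ => aeval z p) = fun z => aeval z Q * G z :=
    (represents_polynomial p).unique_right (hpg ▸ (represents_polynomial Q).mul hg)
  have h2 := zeroCount_aeval p
  rw [h1, zeroCount_aeval_mul hQ0 hg.differentiable hG] at h2
  have h3 : nonrealDegree Q = nonrealDegree p := by exact_mod_cast h2
  exact h3 ▸ (nonrealDegree_le_natDegree Q).trans hQ

theorem nonrealDegree_appell_le_of_mem_limitClass {h : PowerSeries ℝ} {M : ℕ}
    (hh : h ∈ limitClass M) (n : ℕ) : nonrealDegree (appell h n) ≤ M := by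
  rw [← nonrealDegree_reflect (natDegree_appell_le h n)]
  exact nonrealDegree_le_of_coe_mem_limitClass (reflect_appell_mem_limitClass hh n)

/-- Besides membership in `LP*` it keeps the zero bound `B`, which is what forces the eventual
equality in assertion 2. -/
theorem exists_isLPStar_of_nonrealDegree_appell_le {f : PowerSeries ℝ} {B : ℕ}
    (hB : ∀ n, nonrealDegree (appell f n) ≤ B) :
    ∃ F : ℂ → ℂ, Represents f F ∧ IsLPStar F ∧ zeroCount F nonreal ≤ B := by
  rcases eq_or_ne f 0 with rfl | hf
  · have h0 : Represents 0 (0 : ℂ → ℂ) := fun z => by simp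
    refine ⟨0, h0, ⟨h0.isRealEntire, 0, _, isLP_of_tprod_primaryFactor (α := 0) (β := 0) le_rfl
      (b := 0) (by simp), by simp⟩, by simp [zeroCount]⟩
  obtain ⟨c, m, h, hc, hh, rfl⟩ := exists_eq_C_mul_X_pow_mul hf
  have hmem : h ∈ limitClass B := mem_limitClass_of_nonrealDegree_appell_le hh fun n => by
    rw [← nonrealDegree_appell_shift hc m h n]
    exact hB _
  obtain ⟨Q, g, G, hQ, rfl, hg, hLP, hG⟩ := exists_eq_mul_of_mem_limitClass hmem
  have hQ0 : Q ≠ 0 := by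
    rintro rfl
    simp at hh
  set P : ℝ[X] := (C c * X ^ m) * Q with hP
  have hcX : (C c * X ^ m : ℝ[X]) ≠ 0 := by simp [hc]
  have hrep : Represents (PowerSeries.C c * PowerSeries.X ^ m * ((Q : PowerSeries ℝ) * g))
      (fun z => aeval z P * G z) := by
    have := (represents_polynomial P).mul hg
    rw [hP, coe_mul, coe_mul, coe_C, coe_pow, coe_X, mul_assoc _ (Q : PowerSeries ℝ)] at this
    exact this
  refine ⟨_, hrep, ⟨hrep.isRealEntire, P, G, hLP, fun z => rfl⟩, ?_⟩
  rw [zeroCount_aeval_mul (mul_ne_zero hcX hQ0) hg.differentiable hG,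
    nonrealDegree_splits_mul (Splits.C_mul_X_pow c m) hcX]
  exact_mod_cast (nonrealDegree_le_natDegree Q).trans hQ

theorem appell_zero (n : ℕ) : appell 0 n = 0 := by
  simp [appell]

theorem nonrealDegree_appell_le_zeroCount {f : PowerSeries ℝ} {F : ℂ → ℂ} (hf : Represents f F)
    (hF : IsLPStar F) :
    ∃ N : ℕ, zeroCount F nonreal = N ∧ ∀ n, nonrealDegree (appell f n) ≤ N := by
  obtain ⟨-, P, g, ⟨c, m, α, β, J, a, G, hα, ha, hsum, hG, hg⟩, hFPg⟩ := hF
  have hb : Summable fun j => (a j)⁻¹ ^ 2 := by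
    refine hsum.congr fun j => ?_
    rw [sq_abs, inv_pow]
  obtain ⟨γ, hγ, hγ1, hγmem, -⟩ := exists_represents_lp α β hb
  have hGeq : ∀ z, G z = ∏' j, primaryFactor (a j)⁻¹ z := fun z => by
    refine (hG z).unique ?_
    convert! hasProd_primaryFactor hb z using 2 with j
    simp [primaryFactor, mul_comm, div_eq_mul_inv]
  have hFeq : F = fun z => aeval z (P * (C c * X ^ m)) *
      (Complex.exp (-α * z ^ 2 + β * z) * ∏' j, primaryFactor (a j)⁻¹ z) := by
    ext z
    rw [hFPg, hg, hGeq]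
    simp only [map_mul, aeval_C, map_pow, aeval_X, Complex.coe_algebraMap]
    ring
  -- All factors that spoil the normalization go into one polynomial. Its power of `X` and its
  -- lowest nonzero coefficient are split off below, leaving constant term `1`.
  set R : ℝ[X] := P * (C c * X ^ m) with hR
  have hfR : f = R * γ := by
    refine hf.unique_left ?_
    rw [hFeq]
    exact (represents_polynomial R).mul hγ
  rcases eq_or_ne R 0 with hR0 | hR0
  · refine ⟨0, ?_, fun n => ?_⟩
    · have : F = 0 := by rw [hFeq, hR0]; ext; simp
      simp [zeroCount, this]
    · simp [hfR, hR0, appell_zero]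
  have hzero : zeroCount F nonreal = nonrealDegree R := by
    rw [hFeq]
    exact zeroCount_aeval_mul hR0 hγ.differentiable fun z hz =>
      mul_ne_zero (Complex.exp_ne_zero _) (tprod_primaryFactor_ne_zero hb hz)
  refine ⟨_, hzero, ?_⟩
  obtain ⟨q, hq, hdvd⟩ := exists_eq_pow_rootMultiplicity_mul_and_not_dvd R hR0 0
  rw [C_0, sub_zero] at hq hdvd
  have hq0 : q.coeff 0 ≠ 0 := fun h => hdvd (X_dvd_iff.2 h)
  set l := rootMultiplicity 0 R
  set p : ℝ[X] := C (q.coeff 0)⁻¹ * q with hp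
  have hqp : q = C (q.coeff 0) * p := by
    rw [hp, ← mul_assoc, ← C_mul, mul_inv_cancel₀ hq0, C_1, one_mul]
  have hp0 : p.coeff 0 = 1 := by simp [hp, hq0]
  have hpR : nonrealDegree p = nonrealDegree R := by
    rw [hq, nonrealDegree_X_pow_mul, hp, nonrealDegree_C_mul (inv_ne_zero hq0)]
  have hmem : (p : PowerSeries ℝ) * γ ∈ limitClass (nonrealDegree R) := by
    simpa using limitClass_mul (coe_mem_limitClass hp0 hpR.le) (hγmem hα)
  have hfac : f = PowerSeries.C (q.coeff 0) * PowerSeries.X ^ l * ((p : PowerSeries ℝ) * γ) := by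
    rw [hfR, hq]
    nth_rw 1 [hqp]
    simp only [coe_mul, coe_pow, coe_X, coe_C]
    ring
  intro n
  rcases lt_or_ge n l with hn | hn
  · rw [hfac, appell_eq_zero_of_lt _ _ hn]
    simp
  · obtain ⟨e, rfl⟩ := Nat.exists_eq_add_of_le' hn
    rw [hfac, nonrealDegree_appell_shift hq0]
    exact nonrealDegree_appell_le_of_mem_limitClass hmem e

end LaguerrePolya

theorem theorem3p6 (f : PowerSeries ℝ) :
    (LaguerrePolya.appellNonrealZeros f 0 = 0 ∧ LaguerrePolya.appellNonrealZeros f 1 = 0 ∧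
      ∀ n : ℕ, LaguerrePolya.appellNonrealZeros f n ≤ LaguerrePolya.appellNonrealZeros f (n + 1)) ∧
    (∀ F : ℂ → ℂ, LaguerrePolya.Represents f F → LaguerrePolya.IsLPStar F →
      (∀ n : ℕ, LaguerrePolya.appellNonrealZeros f n ≤
        LaguerrePolya.zeroCount F LaguerrePolya.nonreal) ∧
      ∃ n₀ : ℕ, ∀ n : ℕ, n₀ ≤ n →
        LaguerrePolya.appellNonrealZeros f n =
          LaguerrePolya.zeroCount F LaguerrePolya.nonreal) ∧
    ((∃ B : ℕ, ∀ n : ℕ, LaguerrePolya.appellNonrealZeros f n ≤ (B : ℕ∞)) →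
      ∃ F : ℂ → ℂ, LaguerrePolya.Represents f F ∧ LaguerrePolya.IsLPStar F) := by
  simp only [LaguerrePolya.appellNonrealZeros_eq, Nat.cast_le]
  have hmono : Monotone fun n => LaguerrePolya.nonrealDegree (LaguerrePolya.appell f n) :=
    monotone_nat_of_le_succ (LaguerrePolya.nonrealDegree_appell_le_succ f)
  refine ⟨⟨?_, ?_, LaguerrePolya.nonrealDegree_appell_le_succ f⟩, fun F hf hF => ?_, ?_⟩
  · exact_mod_cast LaguerrePolya.nonrealDegree_eq_zero_of_natDegree_le_one
      ((LaguerrePolya.natDegree_appell_le f 0).trans zero_le_one)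
  · exact_mod_cast LaguerrePolya.nonrealDegree_eq_zero_of_natDegree_le_one
      (LaguerrePolya.natDegree_appell_le f 1)
  · obtain ⟨N, hN, hle⟩ := LaguerrePolya.nonrealDegree_appell_le_zeroCount hf hF
    simp only [hN, Nat.cast_le, Nat.cast_inj]
    refine ⟨hle, ?_⟩
    -- The values are bounded by `N`, so a largest one is attained. Used as the bound `B`, it also
    -- bounds the non-real zeros of the represented function, which is `F` by uniqueness of sums.
    obtain ⟨n₀, hn₀⟩ : ∃ n₀, ∀ n,
        LaguerrePolya.nonrealDegree (LaguerrePolya.appell f n) ≤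
          LaguerrePolya.nonrealDegree (LaguerrePolya.appell f n₀) := by
      have hfin : (Set.range fun n =>
          LaguerrePolya.nonrealDegree (LaguerrePolya.appell f n)).Finite :=
        (Set.finite_Iic N).subset (Set.range_subset_iff.2 hle)
      obtain ⟨_, ⟨n₀, rfl⟩, h⟩ := hfin.exists_maximal (Set.range_nonempty _)
      exact ⟨n₀, fun n => (le_total _ _).elim id fun h' => h ⟨n, rfl⟩ h'⟩
    refine ⟨n₀, fun n hn => (hle n).antisymm ?_⟩
    obtain ⟨F', hF', -, hcount⟩ :=
      LaguerrePolya.exists_isLPStar_of_nonrealDegree_appell_le hn₀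
    rw [hF'.unique_right hf, hN] at hcount
    exact (Nat.cast_le.1 hcount).trans (hmono hn)
  · rintro ⟨B, hB⟩
    obtain ⟨F, hF, hLP, -⟩ := LaguerrePolya.exists_isLPStar_of_nonrealDegree_appell_le hB
    exact ⟨F, hF, hLP⟩
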